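/- Let $\underline{\Delta}$ (the fat delta) be the category whose objects are finite non-empty coloured ordinals, i.e. linearly ordered graphs $0\to 1\to\cdots\to n$ with some of the edges marked as links, and whose morphisms are the strictly increasing maps on vertices which send arrows composed of links to arrows composed of links. Let $\pi:\underline{\Delta}\to\Delta$ be the functor contracting all links; a map $f$ of $\underline{\Delta}$ is vertical if $\pi(f)$ is an identity. The category $\Delta_{mono}$ of finite non-empty ordinals and monomorphisms is included in $\underline{\Delta}$ (ordinals without links) and in $\Delta$. A fair $2$-category is a functor $X:\underline{\Delta}^{op}\to\mathrm{Cat}$ such that $X_0=X_{[0]}$ is discrete, $X$ sends pushouts over $[0]$ existing in $\underline{\Delta}$ to pullbacks, and $X$ sends vertical maps to equivalences of categories; $\mathsf{Fair}^2$ is the full subcategory of $[\underline{\Delta}^{op},\mathrm{Cat}]$ on these. A strong Segalic pseudo-functor is a pseudo-functor $H:\Delta^{op}\to\mathrm{Cat}$ with $H_0$ discrete, all of whose Segal maps $H_k\to H_1\times_{H_0}\overset{k}{\cdots}\times_{H_0}H_1$ ($k\ge 2$) are isomorphisms, and whose restriction to $\Delta_{mono}^{op}$ is a strict functor; the morphisms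 in the category $\mathsf{SSegPs}[\Delta^{op},\mathrm{Cat}]$ of these are the pseudo-natural transformations which restrict to strict natural transformations on $\Delta_{mono}^{op}$. **Proposition.** There is a functor $$T_2:\mathsf{Fair}^2\longrightarrow \mathsf{SSegPs}[\Delta^{op},\mathrm{Cat}]$$ such that, for each fair $2$-category $X$, $(T_2X)_0=X_0$, $(T_2X)_1=X_1$ and $(T_2X)_r=X_1\times_{X_0}\overset{r}{\cdots}\times_{X_0}X_1$ for $r\ge 2$ (that is, $(T_2X)_r$ with its $r$ projections to $X_1$ is such an iterated pullback, taken with respect to the source and target maps of $X$, which are also those of $T_2X$). Moreover: (a) the restriction of $T_2X$ to $\Delta_{mono}^{op}$ equals the restriction of $X$ to $\Delta_{mono}^{op}$, as functors of $X\in\mathsf{Fair}^2$; (b) for each fair $2$-category $X$ there is a pseudo-natural transformation $t:\pi^*T_2X\to X$ of pseudo-functors $\underline{\Delta}^{op}\to\mathrm{Cat}$ all of whose components $t_{\underline k}:X_{\pi(\underline k)}=(T_2X)_{\pi(\underline k)}\to X_{\underline k}$ are equivalences of categories, and whose components at the ordinals without links are identities. -/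

import Mathlib

open CategoryTheory Opposite Bicategory
open scoped Simplicial

universe u

namespace Fair

/-! ### The fat delta -/

/-- A finite non-empty coloured (semi-)ordinal: the linearly ordered graph with vertices
`0, …, len` and edges `e : Fin len` (from `e` to `e + 1`), some of which are coloured ("links"). -/
structure FatDelta : Type where
  len : ℕ
  links : Finset (Fin len)

namespace FatDelta

/-- The arrow `i → j` (`i ≤ j`) of the free coloured category on the coloured graph `k` is
coloured iff it is a composite of coloured edges. -/
def Coloured (k : FatDelta) (i j : Fin (k.len + 1)) : Prop :=
  i ≤ j ∧ ∀ e : Fin k.len, i ≤ e.castSucc → e.succ ≤ j → e ∈ k.links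

/-- A morphism of coloured semi-ordinals: a strictly increasing map on vertices
(that is, a semi-functor between semi-ordinals) which preserves coloured arrows. -/
@[ext]
structure Hom (k m : FatDelta) : Type where
  toEmb : Fin (k.len + 1) ↪o Fin (m.len + 1)
  coloured : ∀ i j, k.Coloured i j → m.Coloured (toEmb i) (toEmb j)

instance : Category FatDelta where
  Hom := Hom
  id k := ⟨RelEmbedding.refl _, fun _ _ h => h⟩
  comp f g := ⟨f.toEmb.trans g.toEmb, fun _ _ h => g.coloured _ _ (f.coloured _ _ h)⟩

/-- The number of uncoloured edges of `k` lying below the vertex `i`. -/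
def below (k : FatDelta) (i : Fin (k.len + 1)) : ℕ :=
  (k.linksᶜ.filter fun e => e.castSucc < i).card

theorem below_mono (k : FatDelta) : Monotone k.below := by
  intro i j h
  apply Finset.card_le_card
  intro e he
  simp only [Finset.mem_filter] at he ⊢
  exact ⟨he.1, lt_of_lt_of_le he.2 h⟩

/-- The equiconnected component of a vertex. The components of `k` are numbered
`0, …, c` where `c` is the number of uncoloured edges. -/
def component (k : FatDelta) : Fin (k.len + 1) →o Fin (k.linksᶜ.card + 1) where
  toFun i := ⟨k.below i, Nat.lt_succ_of_le (Finset.card_filter_le _ _)⟩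
  monotone' _ _ h := Fin.mk_le_mk.2 (k.below_mono h)

theorem below_succ_le (k : FatDelta) (e : Fin k.len) :
    k.below e.succ ≤ k.below e.castSucc + 1 := by
  unfold below
  refine le_trans (Finset.card_le_card (t := insert e (k.linksᶜ.filter fun x =>
    x.castSucc < e.castSucc)) ?_) (Finset.card_insert_le _ _)
  intro x hx
  simp only [Finset.mem_filter, Finset.mem_insert] at hx ⊢
  by_cases hxe : x = e
  · exact Or.inl hxe
  · refine Or.inr ⟨hx.1, ?_⟩
    have h1 := hx.2
    have h2 : x.val ≠ e.val := fun h => hxe (Fin.ext h)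
    simp only [Fin.lt_def, Fin.val_castSucc, Fin.val_succ] at h1 ⊢
    omega

theorem component_surjective (k : FatDelta) : Function.Surjective k.component := by
  have key : ∀ (n : ℕ) (hn : n < k.len + 1) (c : ℕ), c ≤ k.below ⟨n, hn⟩ →
      ∃ i, k.below i = c := by
    intro n
    induction n with
    | zero =>
      intro hn c hc
      refine ⟨⟨0, hn⟩, ?_⟩
      have : k.below ⟨0, hn⟩ = 0 := by
        unfold below
        rw [Finset.card_eq_zero, Finset.filter_eq_empty_iff]
        intro x _ h
        simp at h
      omega
    | succ n ih =>
      intro hn c hc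
      have h := k.below_succ_le ⟨n, by omega⟩
      by_cases hc' : c ≤ k.below ⟨n, by omega⟩
      · exact ih _ c hc'
      · refine ⟨⟨n + 1, hn⟩, ?_⟩
        have e1 : (Fin.succ (⟨n, by omega⟩ : Fin k.len)) = ⟨n + 1, hn⟩ := rfl
        have e2 : (Fin.castSucc (⟨n, by omega⟩ : Fin k.len)) = ⟨n, by omega⟩ := rfl
        rw [e1, e2] at h
        omega
  intro c
  have hlast : k.below (Fin.last _) = k.linksᶜ.card := by
    unfold below
    congr 1
    exact Finset.filter_true_of_mem fun x _ => Fin.castSucc_lt_last x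
  obtain ⟨i, hi⟩ := key k.len (Nat.lt_succ_self _) c.val
    (by rw [show (⟨k.len, Nat.lt_succ_self _⟩ : Fin (k.len + 1)) = Fin.last _ from rfl, hlast]
        exact Nat.le_of_lt_succ c.2)
  exact ⟨i, Fin.ext hi⟩

/-- Two vertices lie in the same component iff they are joined by links. -/
theorem coloured_iff (k : FatDelta) {i j : Fin (k.len + 1)} (hij : i ≤ j) :
    k.Coloured i j ↔ k.component i = k.component j := by
  have hsub : (k.linksᶜ.filter fun e => e.castSucc < i) ⊆
      k.linksᶜ.filter fun e => e.castSucc < j := by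
    intro e he
    simp only [Finset.mem_filter] at he ⊢
    exact ⟨he.1, lt_of_lt_of_le he.2 hij⟩
  constructor
  · rintro ⟨-, h⟩
    refine Fin.ext (le_antisymm (k.below_mono hij) (Finset.card_le_card ?_))
    intro e he
    simp only [Finset.mem_filter, Finset.mem_compl] at he ⊢
    refine ⟨he.1, ?_⟩
    by_contra hlt
    refine he.1 (h e (not_lt.1 hlt) ?_)
    have := he.2
    simp only [Fin.lt_def, Fin.le_def, Fin.val_castSucc, Fin.val_succ] at this ⊢
    omega
  · intro h
    refine ⟨hij, fun e he1 he2 => ?_⟩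
    by_contra hne
    have heq := Finset.eq_of_subset_of_card_le hsub (le_of_eq (congrArg Fin.val h).symm)
    have hmem : e ∈ k.linksᶜ.filter fun e => e.castSucc < j := by
      simp only [Finset.mem_filter, Finset.mem_compl]
      refine ⟨hne, ?_⟩
      simp only [Fin.lt_def, Fin.le_def, Fin.val_castSucc, Fin.val_succ] at he2 ⊢
      omega
    rw [← heq, Finset.mem_filter] at hmem
    exact absurd hmem.2 (not_lt.2 he1)

theorem component_congr {k m : FatDelta} (f : k ⟶ m) {i j : Fin (k.len + 1)}
    (h : k.component i = k.component j) :
    m.component (f.toEmb i) = m.component (f.toEmb j) := by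
  rcases le_total i j with hij | hij
  · exact (coloured_iff m (f.toEmb.monotone hij)).1 (f.coloured _ _ ((coloured_iff k hij).2 h))
  · exact ((coloured_iff m (f.toEmb.monotone hij)).1
      (f.coloured _ _ ((coloured_iff k hij).2 h.symm))).symm

/-- The map induced by `f` on equiconnected components. -/
noncomputable def componentMap {k m : FatDelta} (f : k ⟶ m) :
    Fin (k.linksᶜ.card + 1) →o Fin (m.linksᶜ.card + 1) where
  toFun c := m.component (f.toEmb (Function.surjInv k.component_surjective c))
  monotone' c d hcd := by
    rcases eq_or_lt_of_le hcd with rfl | hlt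
    · exact le_rfl
    · apply m.component.monotone
      apply f.toEmb.monotone
      by_contra hcon
      have := k.component.monotone (le_of_lt (not_le.1 hcon))
      rw [Function.surjInv_eq k.component_surjective, Function.surjInv_eq k.component_surjective]
        at this
      exact absurd hlt (not_lt.2 this)

theorem componentMap_component {k m : FatDelta} (f : k ⟶ m) (i : Fin (k.len + 1)) :
    componentMap f (k.component i) = m.component (f.toEmb i) :=
  component_congr f (Function.surjInv_eq k.component_surjective _)

/-- The functor `π` which contracts all the links, i.e. takes equiconnected components. -/
noncomputable def proj : FatDelta ⥤ SimplexCategory where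
  obj k := SimplexCategory.mk k.linksᶜ.card
  map f := SimplexCategory.Hom.mk (componentMap f)
  map_id k := by
    apply SimplexCategory.Hom.ext
    ext c : 2
    obtain ⟨i, rfl⟩ := k.component_surjective c
    exact componentMap_component (𝟙 k) i
  map_comp {k m n} f g := by
    apply SimplexCategory.Hom.ext
    ext c : 2
    obtain ⟨i, rfl⟩ := k.component_surjective c
    refine (componentMap_component (f ≫ g) i).trans ?_
    change _ = componentMap g (componentMap f (k.component i))
    rw [componentMap_component, componentMap_component]
    rfl

/-- The vertical maps (the coloured arrows of the fat delta): those inducing an isomorphism, hence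
an identity, on equiconnected components. -/
def IsVertical {k m : FatDelta} (f : k ⟶ m) : Prop := IsIso (proj.map f)

/-- The inclusion of the category of finite non-empty ordinals and monomorphisms, as the
coloured semi-ordinals without links. -/
def incl : SemiSimplexCategory ⥤ FatDelta where
  obj n := ⟨n.len, ∅⟩
  map {n m} f := ⟨SemiSimplexCategory.homEquiv f, fun i j h =>
    ⟨(SemiSimplexCategory.homEquiv f).monotone h.1, fun e h1 h2 => by
      exfalso
      have hij : i.val ≠ j.val := by
        intro hv
        obtain rfl := Fin.ext hv
        have := h1.trans_lt (Fin.castSucc_lt_succ (i := e)) |>.trans_le h2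
        exact lt_irrefl _ this
      have hlt : i.val < j.val := lt_of_le_of_ne h.1 hij
      have hj : j.val < n.len + 1 := j.2
      exact absurd (h.2 ⟨i.val, by change i.val < n.len; omega⟩ (by simp)
        (by simp only [Fin.le_def, Fin.val_succ]; omega)) (Finset.notMem_empty _)⟩⟩
  map_id _ := rfl
  map_comp _ _ := rfl

theorem proj_obj_incl (n : SemiSimplexCategory) :
    proj.obj (incl.obj n) = SemiSimplexCategory.toSimplexCategory.obj n := by
  change SimplexCategory.mk (Finset.card (∅ : Finset (Fin n.len))ᶜ) = SimplexCategory.mk n.len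
  rw [Finset.compl_empty, Finset.card_univ, Fintype.card_fin]

/-- The one-vertex semi-ordinal. -/
abbrev pt : FatDelta := incl.obj ⦋0⦌ₛ

/-- The inclusion of a vertex. -/
def vertex (k : FatDelta) (i : Fin (k.len + 1)) : pt ⟶ k where
  toEmb := OrderEmbedding.ofStrictMono (fun _ : Fin 1 => i)
    (fun a b h => absurd h (Subsingleton.elim (α := Fin 1) a b ▸ lt_irrefl a))
  coloured _ _ _ := ⟨le_rfl, fun e h1 h2 =>
    absurd ((Fin.castSucc_lt_succ (i := e)).trans_le (h2.trans h1)) (lt_irrefl _)⟩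

end FatDelta

/-! ### Fair 2-categories -/

/-- A fair 2-category: a colour-preserving functor from the opposite of the fat delta to `Cat`
(vertical maps go to equivalences of categories) which preserves discrete objects (the only
discrete object of the source being `pt`) and pullbacks over discrete objects. -/
structure IsFair (X : FatDeltaᵒᵖ ⥤ Cat.{u, u}) : Prop where
  discrete : IsDiscrete (X.obj (op FatDelta.pt))
  segal : ∀ {m n k : FatDelta} (a : FatDelta.pt ⟶ m) (b : FatDelta.pt ⟶ n)
    (i : m ⟶ k) (j : n ⟶ k), IsPushout a b i j →
      IsPullback (X.map i.op) (X.map j.op) (X.map a.op) (X.map b.op)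
  colour : ∀ {k m : FatDelta} (f : k ⟶ m), FatDelta.IsVertical f →
    (X.map f.op).toFunctor.IsEquivalence

/-- The category of fair 2-categories, a full subcategory of the functor category. -/
abbrev FairCat : Type (u + 1) :=
  ObjectProperty.FullSubcategory (fun X : FatDeltaᵒᵖ ⥤ Cat.{u, u} => IsFair X)

/-- Restriction of a fair 2-category to ordinals and monomorphisms. -/
def FairCat.restrict : FairCat.{u} ⥤ (SemiSimplexCategoryᵒᵖ ⥤ Cat.{u, u}) :=
  ObjectProperty.ι _ ⋙ (Functor.whiskeringLeft _ _ _).obj FatDelta.incl.op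

/-- The value `X_n` of a fair 2-category at the ordinal `[n]` (without links). -/
abbrev FairCat.level (X : FairCat.{u}) (n : ℕ) : Cat.{u, u} :=
  X.obj.obj (op (FatDelta.incl.obj ⦋n⦌ₛ))

/-- The source map `X₁ ⟶ X₀`, induced by the vertex `0` of `[1]`. -/
def FairCat.src (X : FairCat.{u}) : X.level 1 ⟶ X.level 0 :=
  X.obj.map (FatDelta.vertex (FatDelta.incl.obj ⦋1⦌ₛ) (0 : Fin 2)).op

/-- The target map `X₁ ⟶ X₀`, induced by the vertex `1` of `[1]`. -/
def FairCat.tgt (X : FairCat.{u}) : X.level 1 ⟶ X.level 0 :=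
  X.obj.map (FatDelta.vertex (FatDelta.incl.obj ⦋1⦌ₛ) (1 : Fin 2)).op

/-- A fair 2-category seen as a pseudo-functor. -/
abbrev FairCat.toPs (X : FairCat.{u}) : LocallyDiscrete FatDeltaᵒᵖ ⥤ᵖ Cat.{u, u} :=
  X.obj.toPseudofunctor'

/-! ### Segalic pseudo-functors -/

/-- `(P, ν)` is the `k`-fold pullback `A ×_O ⋯ ×_O A` of `t` against `s`: the limit of
`O ←s- A -t→ O ←s- A -t→ ⋯ -t→ O` with `k` copies of `A`. -/
structure IsIteratedPullback {O A : Cat.{u, u}} (s t : A ⟶ O) (k : ℕ) {P : Cat.{u, u}}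
    (ν : Fin k → (P ⟶ A)) : Prop where
  condition : ∀ i j : Fin k, i.val + 1 = j.val → ν i ≫ t = ν j ≫ s
  existsUnique_lift : ∀ (Q : Cat.{u, u}) (q : Fin k → (Q ⟶ A)),
    (∀ i j : Fin k, i.val + 1 = j.val → q i ≫ t = q j ≫ s) →
      ∃! l : Q ⟶ P, ∀ i, l ≫ ν i = q i

/-- Pseudo-functors from the opposite of the simplex category to `Cat`. -/
abbrev PsFun : Type (u + 1) := LocallyDiscrete SimplexCategoryᵒᵖ ⥤ᵖ Cat.{u, u}

/-- The value of a pseudo-functor at `[n]`. -/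
abbrev PsFun.level (H : PsFun.{u}) (n : ℕ) : Cat.{u, u} := H.obj ⟨op ⦋n⦌⟩

/-- The action of a pseudo-functor on a simplicial operator. -/
abbrev PsFun.act (H : PsFun.{u}) {m n : ℕ} (f : ⦋m⦌ ⟶ ⦋n⦌) : H.level n ⟶ H.level m :=
  H.map f.op.toLoc

/-- A Segalic pseudo-functor: `H₀` is discrete and all the Segal maps
`H_k ⟶ H₁ ×_{H₀} ⋯ ×_{H₀} H₁` (`k ≥ 2`), induced by the maps `[1] ⟶ [k]` hitting `j - 1` and `j`,
are isomorphisms. -/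
structure PsFun.IsSegalic (H : PsFun.{u}) : Prop where
  discrete : IsDiscrete (H.level 0)
  segal : ∀ k : ℕ, 2 ≤ k →
    IsIteratedPullback (H.act (SimplexCategory.δ 1 : ⦋0⦌ ⟶ ⦋1⦌))
      (H.act (SimplexCategory.δ 0 : ⦋0⦌ ⟶ ⦋1⦌)) k
      (fun j : Fin k => H.act (SimplexCategory.mkOfSucc j))

/-- A morphism of ordinals and monomorphisms, seen in the source of a pseudo-functor. -/
abbrev face {a b : SemiSimplexCategoryᵒᵖ} (f : a ⟶ b) :
    LocallyDiscrete.mk (SemiSimplexCategory.toSimplexCategory.op.obj a) ⟶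
      LocallyDiscrete.mk (SemiSimplexCategory.toSimplexCategory.op.obj b) :=
  (SemiSimplexCategory.toSimplexCategory.op.map f).toLoc

/-- The restriction of `H` to ordinals and monomorphisms is a (strict) functor. -/
structure PsFun.IsStrong (H : PsFun.{u}) : Prop where
  mapId : ∀ a : SemiSimplexCategoryᵒᵖ,
    ∃ h, H.mapId ⟨SemiSimplexCategory.toSimplexCategory.op.obj a⟩ = eqToIso h
  mapComp : ∀ {a b c : SemiSimplexCategoryᵒᵖ} (f : a ⟶ b) (g : b ⟶ c),
    ∃ h, H.mapComp (face f) (face g) = eqToIso h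

/-- The restriction of a pseudo-natural transformation to ordinals and monomorphisms is a
(strict) natural transformation. -/
structure IsStrongTrans {H K : PsFun.{u}} (F : Pseudofunctor.StrongTrans H K) : Prop where
  naturality : ∀ {a b : SemiSimplexCategoryᵒᵖ} (f : a ⟶ b),
    ∃ h, F.naturality (face f) = eqToIso h

/-- Strong Segalic pseudo-functors. -/
structure SSegPs : Type (u + 1) where
  ps : PsFun.{u}
  segalic : ps.IsSegalic
  strong : ps.IsStrong

/-- Morphisms of strong Segalic pseudo-functors: pseudo-natural transformations which are strictly
natural on ordinals and monomorphisms. -/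
@[ext]
structure SSegPs.Hom (H K : SSegPs.{u}) : Type u where
  trans : Pseudofunctor.StrongTrans H.ps K.ps
  strong : IsStrongTrans trans

theorem strongTrans_ext {H K : PsFun.{u}} (F G : Pseudofunctor.StrongTrans H K)
    (happ : F.app = G.app)
    (hnat : ∀ {a b : LocallyDiscrete SimplexCategoryᵒᵖ} (f : a ⟶ b) (x : H.obj a),
      (F.naturality f).hom.toNatTrans.app x ≍ (G.naturality f).hom.toNatTrans.app x) :
    F = G := by
  cases F
  cases G
  dsimp at happ
  subst happ
  congr 1
  funext a b f
  ext1
  apply Cat.Hom₂.ext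
  ext x
  exact eq_of_heq (hnat f x)

theorem id_naturality_app (H : PsFun.{u}) {a b : LocallyDiscrete SimplexCategoryᵒᵖ}
    (f : a ⟶ b) (x : H.obj a) :
    ((Pseudofunctor.StrongTrans.id H).naturality f).hom.toNatTrans.app x =
      𝟙 ((H.map f).toFunctor.obj x) :=
  Category.id_comp (𝟙 ((H.map f).toFunctor.obj x))

theorem vcomp_naturality_app {H K L : PsFun.{u}} (F : Pseudofunctor.StrongTrans H K)
    (G : Pseudofunctor.StrongTrans K L) {a b : LocallyDiscrete SimplexCategoryᵒᵖ}
    (f : a ⟶ b) (x : H.obj a) :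
    ((F.vcomp G).naturality f).hom.toNatTrans.app x =
      (G.app b).toFunctor.map ((F.naturality f).hom.toNatTrans.app x) ≫
        (G.naturality f).hom.toNatTrans.app ((F.app a).toFunctor.obj x) := by
  refine (Category.id_comp _).trans (congrArg (_ ≫ ·) ((Category.id_comp _).trans ?_))
  exact Category.comp_id _

theorem eq_eqToIso {C D : Cat.{u, u}} {F G : C ⟶ D} (e : F ≅ G) (h : F = G)
    (he : ∀ x, e.hom.toNatTrans.app x = eqToHom (by rw [h])) : e = eqToIso h := by
  ext1
  apply Cat.Hom₂.ext
  ext x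
  rw [he]
  simp

theorem isStrongTrans_id (H : PsFun.{u}) : IsStrongTrans (Pseudofunctor.StrongTrans.id H) :=
  ⟨fun f => ⟨rfl, eq_eqToIso _ _ fun x => id_naturality_app H (face f) x⟩⟩

theorem isStrongTrans_vcomp {H K L : PsFun.{u}} {F : Pseudofunctor.StrongTrans H K}
    {G : Pseudofunctor.StrongTrans K L} (hF : IsStrongTrans F) (hG : IsStrongTrans G) :
    IsStrongTrans (F.vcomp G) := by
  constructor
  intro a b f
  obtain ⟨h1, hf⟩ := hF.naturality f
  obtain ⟨h2, hg⟩ := hG.naturality f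
  have h3 : H.map (face f) ≫ (F.vcomp G).app ⟨_⟩ = (F.vcomp G).app ⟨_⟩ ≫ L.map (face f) := by
    change H.map (face f) ≫ F.app _ ≫ G.app _ = (F.app _ ≫ G.app _) ≫ L.map (face f)
    rw [← Category.assoc, h1, Category.assoc, h2, Category.assoc]
  refine ⟨h3, eq_eqToIso _ _ fun x => ?_⟩
  refine (vcomp_naturality_app F G (face f) x).trans ?_
  rw [hf, hg]
  simp [eqToHom_map]
  rfl

theorem id_vcomp {H K : PsFun.{u}} (F : Pseudofunctor.StrongTrans H K) :
    (Pseudofunctor.StrongTrans.id H).vcomp F = F := by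
  refine strongTrans_ext _ _ rfl fun f x => heq_of_eq ?_
  refine (vcomp_naturality_app _ F f x).trans ?_
  refine (congrArg (fun z => (F.app _).toFunctor.map z ≫ _) (id_naturality_app H f x)).trans ?_
  refine (congrArg (· ≫ _) (CategoryTheory.Functor.map_id _ _)).trans ?_
  exact Category.id_comp _

theorem vcomp_id {H K : PsFun.{u}} (F : Pseudofunctor.StrongTrans H K) :
    F.vcomp (Pseudofunctor.StrongTrans.id K) = F := by
  refine strongTrans_ext _ _ rfl fun f x => heq_of_eq ?_
  refine (vcomp_naturality_app F _ f x).trans ?_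
  rw [id_naturality_app]
  exact Category.comp_id _

theorem vcomp_assoc {H K L M : PsFun.{u}} (F : Pseudofunctor.StrongTrans H K)
    (G : Pseudofunctor.StrongTrans K L) (E : Pseudofunctor.StrongTrans L M) :
    (F.vcomp G).vcomp E = F.vcomp (G.vcomp E) := by
  refine strongTrans_ext _ _ rfl fun f x => heq_of_eq ?_
  refine (vcomp_naturality_app _ E f x).trans ?_
  refine Eq.trans ?_ (vcomp_naturality_app F (G.vcomp E) f x).symm
  refine (congrArg (fun z => (E.app _).toFunctor.map z ≫ _)
    (vcomp_naturality_app F G f x)).trans ?_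
  refine Eq.trans ?_ (congrArg (_ ≫ ·) (vcomp_naturality_app G E f _).symm)
  refine (congrArg (· ≫ _) (CategoryTheory.Functor.map_comp _ _ _)).trans ?_
  exact Category.assoc _ _ _

instance : Category SSegPs.{u} where
  Hom := SSegPs.Hom
  id H := ⟨Pseudofunctor.StrongTrans.id H.ps, isStrongTrans_id _⟩
  comp F G := ⟨F.trans.vcomp G.trans, isStrongTrans_vcomp F.strong G.strong⟩
  id_comp F := SSegPs.Hom.ext (id_vcomp F.trans)
  comp_id F := SSegPs.Hom.ext (vcomp_id F.trans)
  assoc F G E := SSegPs.Hom.ext (vcomp_assoc F.trans G.trans E.trans)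

/-- The restriction functor from strong Segalic pseudo-functors to semi-simplicial categories. -/
def SSegPs.restrict : SSegPs.{u} ⥤ (SemiSimplexCategoryᵒᵖ ⥤ Cat.{u, u}) where
  obj H :=
    { obj := fun a => H.ps.obj ⟨SemiSimplexCategory.toSimplexCategory.op.obj a⟩
      map := fun f => H.ps.map (face f)
      map_id := fun a => (H.strong.mapId a).1
      map_comp := fun f g => (H.strong.mapComp f g).1 }
  map F :=
    { app := fun a => F.trans.app ⟨SemiSimplexCategory.toSimplexCategory.op.obj a⟩
      naturality := fun _ _ f => (F.strong.naturality f).1 }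
  map_id _ := rfl
  map_comp _ _ := rfl

/-- The pseudo-functor `π^* H` on the opposite of the fat delta. -/
noncomputable abbrev SSegPs.projPullback (H : SSegPs.{u}) :
    LocallyDiscrete FatDeltaᵒᵖ ⥤ᵖ Cat.{u, u} :=
  FatDelta.proj.op.toPseudofunctor.comp H.ps

end Fair

/-! A link may be contracted by `π`, so a degeneracy of `Δ` is only seen in the fat delta through a
zigzag of maps, the wrong-way ones being vertical, hence invertible up to isomorphism after applying
`X`. To make all choices coherently, one first builds a larger but strictly functorial model. A
chart over `[n]` is an object of the comma category of `π` over `[n]`, and `Desc X n` is the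
category of pseudo-natural families of objects of `X` on the charts over `[n]`, a pointwise pseudo
right Kan extension of `X` along `π`. Charts are pushed forward strictly along monotone maps, so `n
↦ Desc X n` is a strict functor on `Δᵒᵖ`.

The main point is that evaluation at the chart `([n], id)` is an equivalence `Desc X n ≃ X_n`
(`ev_base_faithful`, `ev_base_full`, `ev_base_essSurj`). Every chart `c` sits in a zigzag `c → blow
c ← base n`, natural in `c`, whose right leg is vertical. A descent datum and its morphisms are
therefore determined by, and can be rebuilt from, their value at the base.

The strict functor is then transported along these equivalences, giving a pseudo-functor with values
`X_n`. The transported functor along a monomorphism is chosen to be that of `X`, and the comparison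
isomorphism to be a structure isomorphism of descent data. The composition law of those isomorphisms
makes the coherence cells over `Δ_mono` identities (`transportPs_isStrong`). All coherence laws are
checked on the image of evaluation, where they reduce to the strict functoriality of `Desc`.

Evaluation at the chart `(k, component)` gives `t` in the same way: that chart is exact, so
evaluation there is an equivalence too. The Segal condition concerns monomorphisms only, and follows
from `[n + 1]` being a pushout of `[n]` and `[1]` over `[0]` in the fat delta
(`isPushout_initial_edge`). -/

namespace Fair

/-! ### Charts -/

/-- A chart over `[n]`: a coloured semi-ordinal with a monotone map to `[n]` which contracts
the coloured arrows. This is the same as a map `π shape ⟶ [n]`. -/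
structure Chart (n : ℕ) : Type where
  shape : FatDelta
  map : Fin (shape.len + 1) →o Fin (n + 1)
  contracts : ∀ i j, shape.Coloured i j → map i = map j

namespace Chart

variable {n m : ℕ}

/-- A morphism of charts: a map of coloured semi-ordinals over `[n]`. -/
@[ext]
structure Hom (c d : Chart n) : Type where
  hom : c.shape ⟶ d.shape
  w : ∀ i, d.map (hom.toEmb i) = c.map i

instance : Category (Chart n) where
  Hom := Hom
  id c := ⟨𝟙 c.shape, fun _ => rfl⟩
  comp f g := ⟨f.hom ≫ g.hom, fun i => (g.w _).trans (f.w i)⟩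

@[simp] theorem id_hom (c : Chart n) : Hom.hom (𝟙 c) = 𝟙 c.shape := rfl

@[simp] theorem comp_hom {c d e : Chart n} (f : c ⟶ d) (g : d ⟶ e) :
    (f ≫ g).hom = f.hom ≫ g.hom := rfl

@[ext]
theorem hom_ext {c d : Chart n} {f g : c ⟶ d} (h : f.hom = g.hom) : f = g := Hom.ext h

/-- The chart obtained by composing with a monotone map. -/
def push (c : Chart n) (f : Fin (n + 1) →o Fin (m + 1)) : Chart m where
  shape := c.shape
  map := f.comp c.map
  contracts i j h := congrArg f (c.contracts i j h)

/-- Composing with a monotone map is functorial. -/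
def pushHom {c d : Chart n} (h : c ⟶ d) (f : Fin (n + 1) →o Fin (m + 1)) :
    c.push f ⟶ d.push f where
  hom := h.hom
  w i := congrArg f (h.w i)

/-- A chart is exact if it exhibits `[n]` as the set of equiconnected components. -/
structure IsExact (c : Chart n) : Prop where
  surjective : Function.Surjective c.map
  coloured : ∀ i j, i ≤ j → c.map i = c.map j → c.shape.Coloured i j

theorem IsExact.component_eq_iff {c : Chart n} (hc : c.IsExact) (i j : Fin (c.shape.len + 1)) :
    c.shape.component i = c.shape.component j ↔ c.map i = c.map j := by
  rcases le_total i j with h | h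
  · rw [← FatDelta.coloured_iff _ h]
    exact ⟨c.contracts i j, hc.coloured i j h⟩
  · rw [eq_comm, ← FatDelta.coloured_iff _ h, eq_comm (a := c.map i)]
    exact ⟨c.contracts j i, hc.coloured j i h⟩

/-- Both sets of components are identified with `[n]` by the chart maps, and `f` lies over `[n]`, so
it is bijective on components. This is the only source of vertical maps in the proof. -/
theorem IsExact.isVertical {c d : Chart n} (hc : c.IsExact) (hd : d.IsExact) (f : c ⟶ d) :
    FatDelta.IsVertical f.hom := by
  refine SimplexCategory.isIso_of_bijective (f := FatDelta.proj.map f.hom) ?_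
  change Function.Bijective (FatDelta.componentMap f.hom)
  constructor
  · intro x y h
    obtain ⟨i, rfl⟩ := c.shape.component_surjective x
    obtain ⟨j, rfl⟩ := c.shape.component_surjective y
    rw [FatDelta.componentMap_component, FatDelta.componentMap_component,
      hd.component_eq_iff, f.w, f.w] at h
    exact (hc.component_eq_iff i j).2 h
  · intro y
    obtain ⟨j, rfl⟩ := d.shape.component_surjective y
    obtain ⟨i, hi⟩ := hc.surjective (d.map j)
    refine ⟨c.shape.component i, ?_⟩
    rw [FatDelta.componentMap_component, hd.component_eq_iff, f.w, hi]

/-- The chart given by the ordinal `[m]` and a monotone map. -/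
def ofMap (f : Fin (m + 1) →o Fin (n + 1)) : Chart n where
  shape := FatDelta.incl.obj ⦋m⦌ₛ
  map := f
  contracts i j h := by
    rcases eq_or_lt_of_le h.1 with rfl | hlt
    · rfl
    · have h1 : i.val < m := lt_of_lt_of_le (Fin.lt_def.1 hlt) (Nat.le_of_lt_succ j.2)
      exact absurd (h.2 ⟨i.val, h1⟩ (Fin.le_def.2 le_rfl)
        (Fin.le_def.2 (Nat.succ_le_of_lt (Fin.lt_def.1 hlt)))) (Finset.notMem_empty _)

/-- The terminal-like chart `([n], id)`. -/
def base (n : ℕ) : Chart n := ofMap OrderHom.id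

theorem base_isExact (n : ℕ) : (base n).IsExact where
  surjective i := ⟨i, rfl⟩
  coloured i j _ h := by
    obtain rfl : i = j := h
    exact ⟨le_rfl, fun e h1 h2 =>
      absurd ((Fin.castSucc_lt_succ (i := e)).trans_le (h2.trans h1)) (lt_irrefl _)⟩

/-- The chart of the equiconnected components. -/
def ofShape (k : FatDelta) : Chart k.linksᶜ.card where
  shape := k
  map := k.component
  contracts _ _ h := (k.coloured_iff h.1).1 h

theorem ofShape_isExact (k : FatDelta) : (ofShape k).IsExact where
  surjective := k.component_surjective
  coloured _ _ h := (k.coloured_iff h).2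

/-- The chart with all possible links on a monotone map. -/
def full {L : ℕ} (f : Fin (L + 1) →o Fin (n + 1)) : Chart n where
  shape := ⟨L, Finset.univ.filter fun e => f e.castSucc = f e.succ⟩
  map := f
  contracts := by
    rintro i ⟨j, hj⟩ ⟨hij, h⟩
    -- Descend from `j` to `i` one edge at a time: each edge in between is a link, hence joins
    -- vertices with equal image.
    induction j with
    | zero => exact congrArg f (le_antisymm hij (Fin.zero_le _))
    | succ j ih =>
      rcases eq_or_lt_of_le hij with rfl | hlt
      · rfl
      · have hj' : j < L + 1 := Nat.lt_of_succ_lt hj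
        have hle : i ≤ ⟨j, hj'⟩ := Fin.le_def.2 (Nat.le_of_lt_succ (Fin.lt_def.1 hlt))
        refine (ih hj' hle fun e h1 h2 => h e h1 (h2.trans (Fin.le_def.2 (Nat.le_succ j)))).trans ?_
        have hj2 : j < L := Nat.lt_of_succ_lt_succ hj
        have := h ⟨j, hj2⟩ hle le_rfl
        exact (Finset.mem_filter.1 this).2

theorem full_coloured {L : ℕ} (f : Fin (L + 1) →o Fin (n + 1)) {i j : Fin (L + 1)} (hij : i ≤ j)
    (h : f i = f j) : (full f).shape.Coloured i j :=
  ⟨hij, fun e h1 h2 => Finset.mem_filter.2 ⟨Finset.mem_univ _, le_antisymm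
    (f.monotone (Fin.castSucc_lt_succ (i := e)).le)
    ((f.monotone h2).trans (h.symm.le.trans (f.monotone h1)))⟩⟩

theorem full_isExact {L : ℕ} (f : Fin (L + 1) →o Fin (n + 1)) (hf : Function.Surjective f) :
    (full f).IsExact :=
  ⟨hf, fun _ _ => full_coloured f⟩

/-- A strictly monotone map over `[n]` into a full chart is a map of charts. -/
def toFull {c : Chart n} {L : ℕ} (f : Fin (L + 1) →o Fin (n + 1))
    (h : Fin (c.shape.len + 1) → Fin (L + 1)) (hh : StrictMono h) (w : ∀ i, f (h i) = c.map i) :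
    c ⟶ full f where
  hom :=
    { toEmb := OrderEmbedding.ofStrictMono h hh
      coloured := fun i j hij => full_coloured f (hh.monotone hij.1)
        ((w i).trans ((c.contracts i j hij).trans (w j).symm)) }
  w := w

/-! ### Blowing up -/

/-- The vertex `i` of the block `j`, in the lexicographic product of `[n]` and `[L + 1]`. -/
def vtx {L : ℕ} (j : Fin (n + 1)) (i : Fin (L + 2)) : Fin (n * (L + 2) + (L + 1) + 1) :=
  -- There are `n + 1` blocks of `L + 2` vertices, the last vertex of each block being the
  -- additional one. The total `(n + 1)(L + 2)` is written as a length `n(L + 2) + (L + 1)` plus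
  -- one.
  ⟨j * (L + 2) + i, by
    have := Nat.mul_le_mul_right (L + 2) (Nat.le_of_lt_succ j.2)
    omega⟩

/-- The block of a vertex. -/
def block {L : ℕ} (p : Fin (n * (L + 2) + (L + 1) + 1)) : Fin (n + 1) :=
  ⟨p / (L + 2), by
    rw [Nat.div_lt_iff_lt_mul (by omega), Nat.succ_mul]
    omega⟩

/-- The position of a vertex in its block. -/
def pos {L : ℕ} (p : Fin (n * (L + 2) + (L + 1) + 1)) : Fin (L + 2) :=
  ⟨p % (L + 2), Nat.mod_lt _ (by omega)⟩

@[simp] theorem vtx_block_pos {L : ℕ} (p : Fin (n * (L + 2) + (L + 1) + 1)) :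
    vtx (block p) (pos p) = p :=
  Fin.ext (Nat.div_add_mod' _ _)

@[simp] theorem block_vtx {L : ℕ} (j : Fin (n + 1)) (i : Fin (L + 2)) : block (vtx j i) = j := by
  apply Fin.ext
  change (j.val * (L + 2) + i.val) / (L + 2) = j
  rw [Nat.add_comm, Nat.add_mul_div_right _ _ (by omega), Nat.div_eq_of_lt i.2, Nat.zero_add]

@[simp] theorem pos_vtx {L : ℕ} (j : Fin (n + 1)) (i : Fin (L + 2)) : pos (vtx j i) = i := by
  apply Fin.ext
  change (j.val * (L + 2) + i.val) % (L + 2) = i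
  rw [Nat.add_comm, Nat.add_mul_mod_self_right, Nat.mod_eq_of_lt i.2]

theorem vtx_lt {L : ℕ} {j j' : Fin (n + 1)} {i i' : Fin (L + 2)}
    (h : j < j' ∨ j = j' ∧ i < i') : vtx j i < vtx j' i' := by
  apply Fin.lt_def.2
  change j.val * (L + 2) + i.val < j'.val * (L + 2) + i'.val
  rcases h with h | ⟨rfl, h⟩
  · have := Nat.mul_le_mul_right (L + 2) (Nat.succ_le_of_lt (Fin.lt_def.1 h))
    rw [Nat.succ_mul] at this
    omega
  · have := Fin.lt_def.1 h
    omega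

theorem block_monotone {L : ℕ} : Monotone (block : Fin (n * (L + 2) + (L + 1) + 1) → Fin (n + 1)) :=
  fun _ _ h => Fin.le_def.2 (Nat.div_le_div_right (Fin.le_def.1 h))

theorem lex_of_lt {L : ℕ} {p q : Fin (n * (L + 2) + (L + 1) + 1)} (h : p < q) :
    block p < block q ∨ block p = block q ∧ pos p < pos q := by
  rcases eq_or_lt_of_le (block_monotone h.le) with h1 | h1
  · refine Or.inr ⟨h1, lt_of_not_ge fun h2 => ?_⟩
    rcases eq_or_lt_of_le h2 with h3 | h3
    · rw [← vtx_block_pos p, ← vtx_block_pos q, h1, h3] at h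
      exact lt_irrefl _ h
    · have := vtx_lt (Or.inr ⟨h1.symm, h3⟩ : block q < block p ∨ _)
      rw [vtx_block_pos, vtx_block_pos] at this
      exact lt_asymm h this
  · exact Or.inl h1

/-- The chart over `[n]` all of whose components are copies of the vertices of `c` followed
by an additional vertex. -/
def blow (c : Chart n) : Chart n :=
  full (L := n * (c.shape.len + 2) + (c.shape.len + 1)) ⟨block, block_monotone⟩

theorem blow_isExact (c : Chart n) : c.blow.IsExact :=
  full_isExact _ fun j => ⟨vtx j 0, block_vtx j 0⟩

/-- The embedding of a chart in its blow-up. -/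
def toBlow (c : Chart n) : c ⟶ c.blow :=
  -- `castSucc` leaves the last vertex of every block free. Keeping the index `i` as position makes
  -- the map strict even where `c.map` is constant.
  toFull _ (fun i => vtx (c.map i) i.castSucc)
    (fun i j h => by
      refine vtx_lt ?_
      rcases eq_or_lt_of_le (c.map.monotone h.le) with h1 | h1
      · exact Or.inr ⟨h1, h⟩
      · exact Or.inl h1)
    (fun i => block_vtx _ _)

/-- The additional vertices of the blow-up. -/
def baseToBlow (c : Chart n) : base n ⟶ c.blow :=
  toFull (c := base n) _ (fun j => vtx j (Fin.last _))
    (fun _ _ h => vtx_lt (Or.inl h)) (fun j => block_vtx j _)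

/-- Extension of a strictly monotone map by a new top vertex. -/
def extend {L M : ℕ} (h : Fin (L + 1) → Fin (M + 1)) : Fin (L + 2) → Fin (M + 2) :=
  Fin.lastCases (Fin.last _) fun i => (h i).castSucc

@[simp] theorem extend_last {L M : ℕ} (h : Fin (L + 1) → Fin (M + 1)) :
    extend h (Fin.last _) = Fin.last _ := Fin.lastCases_last

@[simp] theorem extend_castSucc {L M : ℕ} (h : Fin (L + 1) → Fin (M + 1)) (i : Fin (L + 1)) :
    extend h i.castSucc = (h i).castSucc := Fin.lastCases_castSucc _

theorem extend_strictMono {L M : ℕ} {h : Fin (L + 1) → Fin (M + 1)} (hh : StrictMono h) :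
    StrictMono (extend h) := by
  intro i j hij
  induction j using Fin.lastCases with
  | last =>
    induction i using Fin.lastCases with
    | last => exact absurd hij (lt_irrefl _)
    | cast i => rw [extend_last, extend_castSucc]; exact Fin.castSucc_lt_last _
  | cast j =>
    induction i using Fin.lastCases with
    | last => exact absurd (hij.trans (Fin.castSucc_lt_last _)) (lt_irrefl _)
    | cast i => rw [extend_castSucc, extend_castSucc]; exact hh hij

/-- Blowing up is functorial. -/
def blowHom {c d : Chart n} (h : c ⟶ d) : c.blow ⟶ d.blow :=
  toFull (c := c.blow) _ (fun p => vtx (block p) (extend h.hom.toEmb (pos p)))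
    (fun p q hpq => by
      refine vtx_lt ?_
      rcases lex_of_lt hpq with h1 | ⟨h1, h2⟩
      · exact Or.inl h1
      · exact Or.inr ⟨h1, extend_strictMono h.hom.toEmb.strictMono h2⟩)
    (fun p => block_vtx _ _)

theorem hom_ext_apply {c d : Chart n} {f g : c ⟶ d} (h : ∀ i, f.hom.toEmb i = g.hom.toEmb i) :
    f = g :=
  Hom.ext (FatDelta.Hom.ext (RelEmbedding.ext h))

theorem blowHom_comp {c d e : Chart n} (f : c ⟶ d) (g : d ⟶ e) :
    blowHom (f ≫ g) = blowHom f ≫ blowHom g := by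
  apply hom_ext_apply
  intro p
  change vtx (block p) (extend (fun i => g.hom.toEmb (f.hom.toEmb i)) (pos p)) =
    vtx (block (vtx (block p) (extend f.hom.toEmb (pos p))))
      (extend g.hom.toEmb (pos (vtx (block p) (extend f.hom.toEmb (pos p)))))
  rw [block_vtx, pos_vtx]
  congr 1
  generalize pos p = i
  induction i using Fin.lastCases <;> simp

theorem toBlow_blowHom {c d : Chart n} (h : c ⟶ d) : c.toBlow ≫ blowHom h = h ≫ d.toBlow := by
  apply hom_ext_apply
  intro i
  change vtx (block (vtx (c.map i) i.castSucc))
    (extend h.hom.toEmb (pos (vtx (c.map i) i.castSucc))) =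
      vtx (d.map (h.hom.toEmb i)) (h.hom.toEmb i).castSucc
  rw [block_vtx, pos_vtx, extend_castSucc, h.w]

/-- The additional vertices are fixed by every `blowHom`, so the maps `base n → blow c` form a cone.
This is why blocks get a new vertex: a vertex chosen in `c` would not be preserved by maps of
charts. -/
theorem baseToBlow_blowHom {c d : Chart n} (h : c ⟶ d) :
    c.baseToBlow ≫ blowHom h = d.baseToBlow := by
  apply hom_ext_apply
  intro j
  change vtx (block (vtx j (Fin.last _))) (extend h.hom.toEmb (pos (vtx j (Fin.last _)))) =
    vtx j (Fin.last _)
  rw [block_vtx, pos_vtx, extend_last]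

end Chart

/-! ### Descent data -/

section

variable (X : FatDeltaᵒᵖ ⥤ Cat.{u, u})

/-- The action of a map of coloured semi-ordinals. -/
abbrev pull {k m : FatDelta} (f : k ⟶ m) : X.obj (op m) ⥤ X.obj (op k) :=
  (X.map f.op).toFunctor

variable {X}

theorem pull_obj_id {k : FatDelta} (x : X.obj (op k)) : (pull X (𝟙 k)).obj x = x := by
  rw [pull, op_id, X.map_id]
  rfl

/-- The composite enters through an equation `e`, so that two factorisations of one map can be
compared without rewriting inside dependent types. -/
theorem pull_obj_comp {k l m : FatDelta} {f : k ⟶ l} {g : l ⟶ m} {h : k ⟶ m} (e : f ≫ g = h)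
    (x : X.obj (op m)) : (pull X f).obj ((pull X g).obj x) = (pull X h).obj x := by
  subst e
  rw [pull, pull, pull, op_comp, X.map_comp]
  rfl

theorem pull_map_id {k : FatDelta} {x y : X.obj (op k)} (φ : x ⟶ y) :
    (pull X (𝟙 k)).map φ = eqToHom (pull_obj_id x) ≫ φ ≫ eqToHom (pull_obj_id y).symm := by
  have e : pull X (𝟙 k) = 𝟭 _ := by rw [pull, op_id, X.map_id]; rfl
  exact Functor.congr_hom e φ

theorem pull_map_comp {k l m : FatDelta} {f : k ⟶ l} {g : l ⟶ m} {h : k ⟶ m} (e : f ≫ g = h)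
    {x y : X.obj (op m)} (φ : x ⟶ y) :
    (pull X f).map ((pull X g).map φ) =
      eqToHom (pull_obj_comp e x) ≫ (pull X h).map φ ≫ eqToHom (pull_obj_comp e y).symm := by
  have e' : pull X g ⋙ pull X f = pull X h := by
    subst e
    rw [pull, pull, pull, op_comp, X.map_comp]
    rfl
  exact Functor.congr_hom e' φ

variable (X)

/-- A descent datum over `[n]`: a pseudo-natural family of objects of `X` indexed by the charts
over `[n]`. -/
@[ext]
structure Desc (n : ℕ) : Type u where
  obj : ∀ c : Chart n, X.obj (op c.shape)
  iso : ∀ {c d : Chart n} (h : c ⟶ d), obj c ≅ (pull X h.hom).obj (obj d)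
  iso_comp : ∀ {c d e : Chart n} (f : c ⟶ d) (g : d ⟶ e) (h : c ⟶ e) (w : f ≫ g = h),
    (iso h).hom = (iso f).hom ≫ (pull X f.hom).map (iso g).hom ≫
      eqToHom (pull_obj_comp (congrArg Chart.Hom.hom w) _)

namespace Desc

variable {X} {n m : ℕ}

/-- The unit law need not be an axiom: the composition law for `𝟙 ≫ 𝟙 = 𝟙` makes this isomorphism
idempotent up to transport, and an invertible idempotent is an identity. -/
theorem iso_id (x : Desc X n) (c : Chart n) :
    (x.iso (𝟙 c)).hom = eqToHom (pull_obj_id _).symm := by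
  have h := x.iso_comp (𝟙 c) (𝟙 c) (𝟙 c) (Category.id_comp _)
  change _ = _ ≫ (pull X (𝟙 c.shape)).map (x.iso (𝟙 c)).hom ≫ _ at h
  rw [pull_map_id] at h
  have h2 := (cancel_epi (x.iso (𝟙 c)).hom).1 ((Category.comp_id _).trans h)
  simp only [Category.assoc, eqToHom_trans] at h2
  rw [eq_comm, ← Category.assoc, comp_eqToHom_iff, eqToHom_comp_iff] at h2
  rw [h2]
  simp

/-- The compatibility of two morphisms with the structure isomorphisms of descent data. -/
def Sq (x y : Desc X n) {c d : Chart n} (h : c ⟶ d) (φ : x.obj c ⟶ y.obj c)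
    (ψ : x.obj d ⟶ y.obj d) : Prop :=
  φ ≫ (y.iso h).hom = (x.iso h).hom ≫ (pull X h.hom).map ψ

theorem sq_comp_iff (x y : Desc X n) {c d e : Chart n} (f : c ⟶ d) (g : d ⟶ e) (h : c ⟶ e)
    (w : f ≫ g = h) (φ : x.obj c ⟶ y.obj c) (χ : x.obj e ⟶ y.obj e) :
    Sq x y h φ χ ↔ φ ≫ (y.iso f).hom ≫ (pull X f.hom).map (y.iso g).hom =
      (x.iso f).hom ≫ (pull X f.hom).map ((x.iso g).hom ≫ (pull X g.hom).map χ) := by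
  have w' : f.hom ≫ g.hom = h.hom := congrArg Chart.Hom.hom w
  rw [Sq, y.iso_comp f g h w, x.iso_comp f g h w, Functor.map_comp, pull_map_comp w',
    ← Category.assoc, ← Category.assoc, comp_eqToHom_iff]
  simp

theorem Sq.of_comp {x y : Desc X n} {c d e : Chart n} {f : c ⟶ d} {g : d ⟶ e} {h : c ⟶ e}
    (w : f ≫ g = h) {φ : x.obj c ⟶ y.obj c} {ψ : x.obj d ⟶ y.obj d} {χ : x.obj e ⟶ y.obj e}
    (h1 : Sq x y h φ χ) (h2 : Sq x y g ψ χ) : Sq x y f φ ψ := by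
  rw [sq_comp_iff x y f g h w, ← h2, Functor.map_comp] at h1
  simp only [← Category.assoc] at h1
  exact (cancel_mono _).1 h1

/-- The square over `g` is only seen after pulling back along `f`; faithfulness of that pullback
recovers it. -/
theorem Sq.of_faithful {x y : Desc X n} {c d e : Chart n} {f : c ⟶ d} {g : d ⟶ e} {h : c ⟶ e}
    (w : f ≫ g = h) {φ : x.obj c ⟶ y.obj c} {ψ : x.obj d ⟶ y.obj d} {χ : x.obj e ⟶ y.obj e}
    (h1 : Sq x y h φ χ) (h2 : Sq x y f φ ψ) [(pull X f.hom).Faithful] : Sq x y g ψ χ := by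
  rw [sq_comp_iff x y f g h w, ← Category.assoc, h2, Category.assoc, ← Functor.map_comp] at h1
  exact (pull X f.hom).map_injective ((cancel_epi _).1 h1)

/-- Morphisms of descent data. -/
@[ext]
structure Hom (x y : Desc X n) : Type u where
  app : ∀ c : Chart n, x.obj c ⟶ y.obj c
  sq : ∀ {c d : Chart n} (h : c ⟶ d), Sq x y h (app c) (app d)

instance : Category (Desc X n) where
  Hom := Hom
  id x := ⟨fun _ => 𝟙 _, fun h => by
    rw [Sq, CategoryTheory.Functor.map_id, Category.id_comp, Category.comp_id]⟩
  comp f g := ⟨fun c => f.app c ≫ g.app c, fun h => by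
    rw [Sq, Category.assoc, g.sq h, ← Category.assoc, f.sq h, Category.assoc,
      ← Functor.map_comp]⟩

@[simp] theorem id_app (x : Desc X n) (c : Chart n) : Hom.app (𝟙 x) c = 𝟙 _ := rfl

@[simp] theorem comp_app {x y z : Desc X n} (f : x ⟶ y) (g : y ⟶ z) (c : Chart n) :
    (f ≫ g).app c = f.app c ≫ g.app c := rfl

/-- Restriction of descent data along a monotone map. -/
def res (f : Fin (m + 1) →o Fin (n + 1)) : Desc X n ⥤ Desc X m where
  obj x :=
    { obj := fun c => x.obj (c.push f)
      iso := fun h => x.iso (Chart.pushHom h f)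
      iso_comp := fun {c d e} a b h w => x.iso_comp (Chart.pushHom a f) (Chart.pushHom b f)
        (Chart.pushHom h f) (Chart.hom_ext (congrArg (fun h => h.hom) w : a.hom ≫ b.hom = h.hom)) }
  map φ := ⟨fun c => φ.app (c.push f), fun h => φ.sq (Chart.pushHom h f)⟩

variable (X) in
/-- Evaluation of descent data at a chart. -/
def ev (c : Chart n) : Desc X n ⥤ X.obj (op c.shape) where
  obj x := x.obj c
  map φ := φ.app c

/-- The structure isomorphisms of descent data, as natural isomorphisms. -/
def evIso {c d : Chart n} (h : c ⟶ d) : ev X c ≅ ev X d ⋙ pull X h.hom :=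
  NatIso.ofComponents (fun x => x.iso h) (fun φ => φ.sq h)

/-- The functor on descent data induced by a natural transformation. -/
def mapNat {X' : FatDeltaᵒᵖ ⥤ Cat.{u, u}} (F : X ⟶ X') (n : ℕ) : Desc X n ⥤ Desc X' n where
  obj x :=
    { obj := fun c => (F.app _).toFunctor.obj (x.obj c)
      iso := fun h => (F.app _).toFunctor.mapIso (x.iso h) ≪≫
        eqToIso (Functor.congr_obj congr(($(F.naturality h.hom.op)).toFunctor) _)
      iso_comp := by
        intro c d e f g h w
        have w' : f.hom ≫ g.hom = h.hom := congrArg Chart.Hom.hom w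
        have e2 := Functor.congr_hom congr(($(F.naturality f.hom.op)).toFunctor) (x.iso g).hom
        simp only [Cat.Hom.comp_toFunctor, Functor.comp_map] at e2
        simp only [Iso.trans_hom, Functor.mapIso_hom, eqToIso.hom, x.iso_comp f g h w,
          Functor.map_comp, eqToHom_map, Category.assoc, eqToHom_trans, e2] }
  map {x y} φ :=
    { app := fun c => (F.app _).toFunctor.map (φ.app c)
      sq := fun {c d} h => by
        have e2 := Functor.congr_hom congr(($(F.naturality h.hom.op)).toFunctor) (φ.app d)
        have e3 := congrArg (F.app _).toFunctor.map (φ.sq h)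
        simp only [Cat.Hom.comp_toFunctor, Functor.comp_map, Functor.map_comp] at e2 e3
        simp only [Sq, Iso.trans_hom, Functor.mapIso_hom, eqToIso.hom, Category.assoc]
        rw [reassoc_of% e3, e2]
        simp }
  map_id x := by
    apply Hom.ext
    funext c
    exact (F.app _).toFunctor.map_id _
  map_comp f g := by
    apply Hom.ext
    funext c
    exact (F.app _).toFunctor.map_comp _ _

end Desc

end

/-! ### Evaluation at the base chart -/

/-- A functor from the opposite of the fat delta to `Cat` which sends vertical maps to
equivalences. -/
structure IsColourPreserving (X : FatDeltaᵒᵖ ⥤ Cat.{u, u}) : Prop where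
  colour : ∀ {k m : FatDelta} (f : k ⟶ m), FatDelta.IsVertical f →
    (X.map f.op).toFunctor.IsEquivalence

theorem IsFair.isColourPreserving {X : FatDeltaᵒᵖ ⥤ Cat.{u, u}} (h : IsFair X) :
    IsColourPreserving X :=
  ⟨h.colour⟩

namespace Desc

variable {X : FatDeltaᵒᵖ ⥤ Cat.{u, u}} {n : ℕ}

theorem pull_baseToBlow_isEquivalence (hX : IsColourPreserving X) (c : Chart n) :
    (pull X c.baseToBlow.hom).IsEquivalence :=
  hX.colour _ ((Chart.base_isExact n).isVertical c.blow_isExact _)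

/-- Along `c → blow c ← base n`, the component at the base fixes the one at `blow c` because
pullback along the vertical leg is faithful, and that one fixes the component at `c` because
structure maps are invertible. -/
theorem ev_base_faithful (hX : IsColourPreserving X) : (ev X (Chart.base n)).Faithful where
  map_injective {x y} φ ψ h := by
    apply Hom.ext
    funext c
    have := pull_baseToBlow_isEquivalence hX c
    have h1 : φ.app c.blow = ψ.app c.blow := by
      apply (pull X c.baseToBlow.hom).map_injective
      rw [← cancel_epi (x.iso c.baseToBlow).hom, ← φ.sq c.baseToBlow, ← ψ.sq c.baseToBlow]
      exact congrArg (· ≫ _) h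
    rw [← cancel_mono (y.iso c.toBlow).hom, φ.sq c.toBlow, ψ.sq c.toBlow, h1]

/-- The given map is extended along the zigzag: `ψ c` on the blow-up by fullness over the vertical
leg, then `χ c` by conjugating the pullback of `ψ c`. Naturality of both legs in `c` makes `χ` a
morphism. -/
theorem ev_base_full (hX : IsColourPreserving X) : (ev X (Chart.base n)).Full where
  map_surjective {x y} φ := by
    have heq := fun c : Chart n => pull_baseToBlow_isEquivalence hX c
    have hψ : ∀ c : Chart n, ∃ ψ : x.obj c.blow ⟶ y.obj c.blow, Sq x y c.baseToBlow φ ψ := by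
      intro c
      obtain ⟨ψ, hψ⟩ := (pull X c.baseToBlow.hom).map_surjective
        ((x.iso c.baseToBlow).inv ≫ φ ≫ (y.iso c.baseToBlow).hom)
      refine ⟨ψ, ?_⟩
      unfold Sq
      rw [hψ]
      exact (Iso.hom_inv_id_assoc _ _).symm
    choose ψ hψ using hψ
    have hψ' : ∀ {c d : Chart n} (h : c ⟶ d), Sq x y (Chart.blowHom h) (ψ c) (ψ d) :=
      fun {c d} h => Sq.of_faithful (Chart.baseToBlow_blowHom h) (hψ d) (hψ c)
    have hχ : ∀ c : Chart n, ∃ χ : x.obj c ⟶ y.obj c, Sq x y c.toBlow χ (ψ c) := fun c =>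
      ⟨(x.iso c.toBlow).hom ≫ (pull X c.toBlow.hom).map (ψ c) ≫ (y.iso c.toBlow).inv, by
        simp [Sq]⟩
    choose χ hχ using hχ
    have hχ' : ∀ {c d : Chart n} (h : c ⟶ d), Sq x y h (χ c) (χ d) := fun {c d} h =>
      Sq.of_comp (Chart.toBlow_blowHom h).symm
        ((sq_comp_iff x y _ _ _ rfl _ _).2 (by rw [← hψ' h, Functor.map_comp, ← Category.assoc,
          hχ c, Category.assoc])) (hχ d)
    refine ⟨⟨χ, hχ'⟩, ?_⟩
    -- It remains to see that `χ` at the base is `φ`. There are two different vertical maps from the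
    -- base to its blow-up; `χ` was built with `toBlow` and `ψ` with `baseToBlow`. Both are compared
    -- through `χ` at the blow-up of the base.
    have hι : (pull X (Chart.base n).toBlow.hom).IsEquivalence :=
      hX.colour _ ((Chart.base_isExact n).isVertical (Chart.blow_isExact _) _)
    have h1 : ψ (Chart.base n) = χ (Chart.base n).blow := by
      apply (pull X (Chart.base n).toBlow.hom).map_injective
      rw [← cancel_epi (x.iso (Chart.base n).toBlow).hom, ← hχ, ← hχ']
    have h2 := hψ (Chart.base n)
    rw [h1] at h2
    exact (cancel_mono (y.iso (Chart.base n).baseToBlow).hom).1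
      ((hχ' (Chart.base n).baseToBlow).trans h2.symm)

/-- Lift `a` to each blow-up through the vertical leg, then restrict to `c`. Full faithfulness of
pullback along that leg makes the lifts compatible, with the composition law automatic. -/
theorem ev_base_essSurj (hX : IsColourPreserving X) : (ev X (Chart.base n)).EssSurj where
  mem_essImage a := by
    have heq := fun c : Chart n => pull_baseToBlow_isEquivalence hX c
    let b : ∀ c : Chart n, X.obj (op c.blow.shape) := fun c =>
      (pull X c.baseToBlow.hom).objPreimage a
    let θ : ∀ c : Chart n, a ≅ (pull X c.baseToBlow.hom).obj (b c) := fun c =>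
      ((pull X c.baseToBlow.hom).objObjPreimageIso a).symm
    have hs : ∀ {c d : Chart n} (h : c ⟶ d),
        c.baseToBlow.hom ≫ (Chart.blowHom h).hom = d.baseToBlow.hom :=
      fun h => congrArg Chart.Hom.hom (Chart.baseToBlow_blowHom h)
    let β : ∀ {c d : Chart n} (h : c ⟶ d), b c ≅ (pull X (Chart.blowHom h).hom).obj (b d) :=
      fun {c d} h => (pull X c.baseToBlow.hom).preimageIso
        ((θ c).symm ≪≫ θ d ≪≫ eqToIso (pull_obj_comp (hs h) (b d)).symm)
    have hβ : ∀ {c d : Chart n} (h : c ⟶ d), (pull X c.baseToBlow.hom).map (β h).hom =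
        (θ c).inv ≫ (θ d).hom ≫ eqToHom (pull_obj_comp (hs h) (b d)).symm := by
      intro c d h
      simp [β]
    have hc : ∀ {c d e : Chart n} (f : c ⟶ d) (g : d ⟶ e) (h : c ⟶ e) (w : f ≫ g = h),
        (β h).hom = (β f).hom ≫ (pull X (Chart.blowHom f).hom).map (β g).hom ≫
          eqToHom (pull_obj_comp (congrArg Chart.Hom.hom
            ((Chart.blowHom_comp f g).symm.trans (congrArg Chart.blowHom w))) (b e)) := by
      intro c d e f g h w
      apply (pull X c.baseToBlow.hom).map_injective
      rw [Functor.map_comp, Functor.map_comp, hβ, hβ, pull_map_comp (hs f), hβ, eqToHom_map]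
      simp
    let x : Desc X n :=
      { obj := fun c => (pull X c.toBlow.hom).obj (b c)
        iso := fun {c d} h => (pull X c.toBlow.hom).mapIso (β h) ≪≫ eqToIso
          ((pull_obj_comp (congrArg Chart.Hom.hom (Chart.toBlow_blowHom h)) _).trans
            (pull_obj_comp rfl _).symm)
        iso_comp := by
          intro c d e f g h w
          simp only [Iso.trans_hom, Functor.mapIso_hom, eqToIso.hom, hc f g h w, Functor.map_comp,
            eqToHom_map]
          rw [pull_map_comp (congrArg Chart.Hom.hom (Chart.toBlow_blowHom f)),
            pull_map_comp (h := f.hom ≫ d.toBlow.hom) rfl]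
          simp }
    have hι : (pull X (Chart.base n).toBlow.hom).IsEquivalence :=
      hX.colour _ ((Chart.base_isExact n).isVertical (Chart.blow_isExact _) _)
    -- Both sides pull back along `toBlow` to `x.obj (base n)`, up to isomorphism: the left by the
    -- structure map, the right by definition. Since `toBlow` is vertical at the base, they are
    -- isomorphic.
    have i : x.obj (Chart.base n).blow ≅ b (Chart.base n) :=
      ((pull X (Chart.base n).toBlow.hom).preimageIso (x.iso (Chart.base n).toBlow)).symm
    exact ⟨x, ⟨x.iso (Chart.base n).baseToBlow ≪≫
      (pull X (Chart.base n).baseToBlow.hom).mapIso i ≪≫ (θ (Chart.base n)).symm⟩⟩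

/-- Evaluation at the base chart is an equivalence. -/
theorem ev_base_isEquivalence (hX : IsColourPreserving X) (n : ℕ) :
    (ev X (Chart.base n)).IsEquivalence where
  faithful := ev_base_faithful hX
  full := ev_base_full hX
  essSurj := ev_base_essSurj hX

/-- Evaluation at an exact chart is an equivalence. -/
theorem ev_isEquivalence (hX : IsColourPreserving X) {c : Chart n} (hc : c.IsExact) :
    (ev X c).IsEquivalence := by
  have h1 := ev_base_isEquivalence hX n
  have h2 := pull_baseToBlow_isEquivalence hX c
  have h3 : (pull X c.toBlow.hom).IsEquivalence := hX.colour _ (hc.isVertical c.blow_isExact _)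
  have h4 : (ev X c.blow ⋙ pull X c.baseToBlow.hom).IsEquivalence :=
    Functor.isEquivalence_of_iso (evIso c.baseToBlow)
  have h5 : (ev X c.blow).IsEquivalence :=
    Functor.isEquivalence_of_comp_right _ (pull X c.baseToBlow.hom)
  exact Functor.isEquivalence_of_iso (evIso c.toBlow).symm

end Desc

/-! ### Constructors in components -/

section

/-- Extension of a natural isomorphism along an equivalence. -/
noncomputable def extendIso {A B D : Type*} [Category* A] [Category* B] [Category* D]
    (E : A ⥤ B) [E.IsEquivalence] {F G : B ⥤ D} (τ : E ⋙ F ≅ E ⋙ G) : F ≅ G :=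
  ((Functor.whiskeringLeft A B D).obj E).preimageIso τ

@[simp] theorem extendIso_hom_app {A B D : Type*} [Category* A] [Category* B] [Category* D]
    (E : A ⥤ B) [E.IsEquivalence] {F G : B ⥤ D} (τ : E ⋙ F ≅ E ⋙ G) (a : A) :
    (extendIso E τ).hom.app (E.obj a) = τ.hom.app a :=
  NatTrans.congr_app (((Functor.whiskeringLeft A B D).obj E).map_preimage τ.hom) a

/-- A natural transformation is determined on an essentially surjective image. With `E` the
evaluation at the base, this reduces every coherence law to objects underlying descent data. -/
theorem eq_of_app_eq {A B D : Type*} [Category* A] [Category* B] [Category* D]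
    (E : A ⥤ B) [E.EssSurj] {F G : B ⥤ D} {σ τ : F ⟶ G}
    (h : ∀ a, σ.app (E.obj a) = τ.app (E.obj a)) : σ = τ := by
  ext b
  rw [← cancel_epi (F.map (E.objObjPreimageIso b).hom), σ.naturality, τ.naturality, h]

/-- Constructor for pseudofunctors from a category to `Cat`, with axioms stated in components. -/
def pseudofunctorOfComponents {B : Type*} [Category* B] (obj : B → Cat.{u, u})
    (map : ∀ {b b' : B}, (b ⟶ b') → (obj b ⟶ obj b'))
    (mapId : ∀ b : B, map (𝟙 b) ≅ 𝟙 _)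
    (mapComp : ∀ {b₀ b₁ b₂ : B} (f : b₀ ⟶ b₁) (g : b₁ ⟶ b₂), map (f ≫ g) ≅ map f ≫ map g)
    (assoc : ∀ {b₀ b₁ b₂ b₃ : B} (f : b₀ ⟶ b₁) (g : b₁ ⟶ b₂) (h : b₂ ⟶ b₃) (x : obj b₀),
      (mapComp (f ≫ g) h).hom.toNatTrans.app x ≫
        (map h).toFunctor.map ((mapComp f g).hom.toNatTrans.app x) =
      eqToHom (by rw [Category.assoc]) ≫ (mapComp f (g ≫ h)).hom.toNatTrans.app x ≫
        (mapComp g h).hom.toNatTrans.app ((map f).toFunctor.obj x))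
    (left_unit : ∀ {b₀ b₁ : B} (f : b₀ ⟶ b₁) (x : obj b₀),
      (mapComp (𝟙 b₀) f).hom.toNatTrans.app x ≫
        (map f).toFunctor.map ((mapId b₀).hom.toNatTrans.app x) =
      eqToHom (by rw [Category.id_comp]; rfl))
    (right_unit : ∀ {b₀ b₁ : B} (f : b₀ ⟶ b₁) (x : obj b₀),
      (mapComp f (𝟙 b₁)).hom.toNatTrans.app x ≫
        (mapId b₁).hom.toNatTrans.app ((map f).toFunctor.obj x) =
      eqToHom (by rw [Category.comp_id]; rfl)) :
    LocallyDiscrete B ⥤ᵖ Cat.{u, u} :=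
  LocallyDiscrete.mkPseudofunctor obj map mapId mapComp
    (by
      intro b₀ b₁ b₂ b₃ f g h
      apply Cat.Hom₂.ext
      ext x
      rw [Cat.Hom₂.eqToHom_toNatTrans, eqToHom_app]
      refine Eq.trans (b := ((mapComp (f ≫ g) h).hom.toNatTrans.app x ≫
        (map h).toFunctor.map ((mapComp f g).hom.toNatTrans.app x)) ≫ 𝟙 _ ≫
        (mapComp g h).inv.toNatTrans.app ((map f).toFunctor.obj x) ≫
          (mapComp f (g ≫ h)).inv.toNatTrans.app x) (Category.assoc _ _ _).symm ?_
      rw [assoc, Category.id_comp, Category.assoc (obj := obj b₃), Category.assoc (obj := obj b₃),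
        Cat.Hom.hom_inv_id_toNatTrans_app_assoc, Cat.Hom.hom_inv_id_toNatTrans_app]
      exact Category.comp_id _)
    (by
      intro b₀ b₁ f
      apply Cat.Hom₂.ext
      ext x
      rw [Cat.Hom₂.eqToHom_toNatTrans, eqToHom_app]
      exact (congrArg (_ ≫ ·) (Category.comp_id _)).trans (left_unit f x))
    (by
      intro b₀ b₁ f
      apply Cat.Hom₂.ext
      ext x
      rw [Cat.Hom₂.eqToHom_toNatTrans, eqToHom_app]
      exact (congrArg (_ ≫ ·) (Category.comp_id _)).trans (right_unit f x))

/-- Constructor for strong transformations between pseudofunctors from a locally discrete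
bicategory to `Cat`, with axioms stated in components. -/
def strongTransOfComponents {B : Type*} [Category* B] {P Q : LocallyDiscrete B ⥤ᵖ Cat.{u, u}}
    (app : ∀ b, P.obj b ⟶ Q.obj b)
    (naturality : ∀ {b b' : LocallyDiscrete B} (f : b ⟶ b'), P.map f ≫ app b' ≅ app b ≫ Q.map f)
    (naturality_id : ∀ (b : LocallyDiscrete B) (x : P.obj b),
      (naturality (𝟙 b)).hom.toNatTrans.app x ≫
        (Q.mapId b).hom.toNatTrans.app ((app b).toFunctor.obj x) =
      (app b).toFunctor.map ((P.mapId b).hom.toNatTrans.app x))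
    (naturality_comp : ∀ {a b c : LocallyDiscrete B} (f : a ⟶ b) (g : b ⟶ c) (x : P.obj a),
      (naturality (f ≫ g)).hom.toNatTrans.app x ≫
        (Q.mapComp f g).hom.toNatTrans.app ((app a).toFunctor.obj x) =
      (app c).toFunctor.map ((P.mapComp f g).hom.toNatTrans.app x) ≫
        (naturality g).hom.toNatTrans.app ((P.map f).toFunctor.obj x) ≫
        (Q.map g).toFunctor.map ((naturality f).hom.toNatTrans.app x)) :
    Pseudofunctor.StrongTrans P Q where
  app := app
  naturality := naturality
  naturality_naturality {a b f g} η := by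
    obtain rfl := obj_ext_of_isDiscrete η
    obtain rfl : η = 𝟙 f := Subsingleton.elim _ _
    simp
  naturality_id b := by
    apply Cat.Hom₂.ext
    ext x
    refine (naturality_id b x).trans ?_
    exact ((congrArg (_ ≫ ·) (Category.comp_id (𝟙 _))).trans (Category.comp_id _)).symm
  naturality_comp f g := by
    apply Cat.Hom₂.ext
    ext x
    refine (naturality_comp f g x).trans ?_
    refine Eq.symm ?_
    refine congrArg (_ ≫ ·) ((Category.id_comp _).trans (congrArg (_ ≫ ·) ?_))
    exact (Category.id_comp _).trans (Category.comp_id _)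

end

/-! ### The pseudo-functor associated with a colour preserving functor -/

section

variable (X : FatDeltaᵒᵖ ⥤ Cat.{u, u})

/-- The value at an ordinal without links. -/
abbrev lev (n : SimplexCategory) : Cat.{u, u} := X.obj (op (FatDelta.incl.obj ⦋n.len⦌ₛ))

/-- Evaluation of descent data at the base chart. -/
def evBase (n : SimplexCategory) : Desc X n.len ⥤ lev X n := Desc.ev X (Chart.base n.len)

theorem evBase_isEquivalence {X : FatDeltaᵒᵖ ⥤ Cat.{u, u}} (hX : IsColourPreserving X)
    (n : SimplexCategory) : (evBase X n).IsEquivalence :=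
  Desc.ev_base_isEquivalence hX n.len

/-- Restriction of descent data along a simplicial operator. -/
abbrev resOp {m n : SimplexCategory} (f : m ⟶ n) : Desc X n.len ⥤ Desc X m.len :=
  Desc.res f.toOrderHom

/-- A functor corresponding to the restriction of descent data under evaluation. -/
structure Transport {m n : SimplexCategory} (f : m ⟶ n) : Type u where
  map : lev X n ⟶ lev X m
  iso : resOp X f ⋙ evBase X m ≅ evBase X n ⋙ map.toFunctor

/-- The map of coloured semi-ordinals given by an order embedding. -/
def embMap {m n : ℕ} (e : Fin (m + 1) ↪o Fin (n + 1)) :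
    FatDelta.incl.obj ⦋m⦌ₛ ⟶ FatDelta.incl.obj ⦋n⦌ₛ :=
  FatDelta.incl.map (SemiSimplexCategory.homEquiv.symm e)

/-- The map of charts given by an order embedding. -/
def embChart {m n : ℕ} (e : Fin (m + 1) ↪o Fin (n + 1)) :
    (Chart.base m).push e.toOrderHom ⟶ Chart.base n where
  hom := embMap e
  w _ := rfl

/-- On monomorphisms, the restriction of descent data corresponds to the given functor. -/
def monoTransport {m n : SemiSimplexCategory} (f : m ⟶ n) :
    Transport X (SemiSimplexCategory.toSimplexCategory.map f) where
  map := X.map (FatDelta.incl.map f).op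
  iso := Desc.evIso (embChart (SemiSimplexCategory.homEquiv f))

open Classical in
/-- A choice of transported functors, extending the one on monomorphisms. -/
noncomputable def transport (hX : IsColourPreserving X) {m n : SimplexCategory} (f : m ⟶ n) :
    Transport X f :=
  -- Transport through the inverse of evaluation would agree with `X` on monomorphisms only up to
  -- isomorphism, so these are treated separately to obtain strictness.
  if h : ∃ f' : (⦋m.len⦌ₛ : SemiSimplexCategory) ⟶ ⦋n.len⦌ₛ,
      SemiSimplexCategory.toSimplexCategory.map f' = f then
    h.choose_spec ▸ monoTransport X h.choose
  else
    have := evBase_isEquivalence hX n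
    { map := ((evBase X n).inv ⋙ resOp X f ⋙ evBase X m).toCatHom
      iso := (Functor.leftUnitor _).symm ≪≫
        Functor.isoWhiskerRight (evBase X n).asEquivalence.unitIso _ ≪≫
        Functor.associator _ _ _ }

/-- The chosen preimage `f'` is `f` itself, since `Δ_mono → Δ` is faithful. -/
theorem transport_map (hX : IsColourPreserving X) {m n : SemiSimplexCategory} (f : m ⟶ n) :
    transport X hX (SemiSimplexCategory.toSimplexCategory.map f) = monoTransport X f := by
  have h : ∃ f' : m ⟶ n, SemiSimplexCategory.toSimplexCategory.map f' =
    SemiSimplexCategory.toSimplexCategory.map f := ⟨f, rfl⟩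
  have key : ∀ (f' : m ⟶ n) (e : SemiSimplexCategory.toSimplexCategory.map f' =
      SemiSimplexCategory.toSimplexCategory.map f), e ▸ monoTransport X f' = monoTransport X f := by
    intro f' e
    obtain rfl := SemiSimplexCategory.toSimplexCategory.map_injective e
    rfl
  exact (dif_pos h).trans (key _ _)

variable {X} (hX : IsColourPreserving X)

/-- The transported functor. -/
noncomputable abbrev tmap {m n : SimplexCategory} (f : m ⟶ n) : lev X n ⟶ lev X m :=
  (transport X hX f).map

/-- The structure isomorphism of the transported functor. -/
noncomputable abbrev tiso {m n : SimplexCategory} (f : m ⟶ n) (x : Desc X n.len) :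
    (evBase X m).obj ((resOp X f).obj x) ≅ (tmap hX f).toFunctor.obj ((evBase X n).obj x) :=
  (transport X hX f).iso.app x

/-- The comparison with the identity. -/
noncomputable def tmapId (n : SimplexCategory) : tmap hX (𝟙 n) ≅ 𝟙 (lev X n) :=
  have := evBase_isEquivalence hX n
  Cat.Hom.isoMk (extendIso (evBase X n) (F := (tmap hX (𝟙 n)).toFunctor) (G := 𝟭 _)
    ((transport X hX (𝟙 n)).iso.symm ≪≫ (Functor.rightUnitor (evBase X n)).symm))

theorem tiso_tmapId (n : SimplexCategory) (x : Desc X n.len) :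
    (tiso hX (𝟙 n) x).hom ≫ (tmapId hX n).hom.toNatTrans.app ((evBase X n).obj x) = 𝟙 _ := by
  have := evBase_isEquivalence hX n
  refine (congrArg (_ ≫ ·) (extendIso_hom_app (evBase X n) _ x)).trans ?_
  refine (congrArg (_ ≫ ·) (Category.comp_id _)).trans ?_
  exact (tiso hX (𝟙 n) x).hom_inv_id

/-- The comparison with composition. -/
noncomputable def tmapComp {k m n : SimplexCategory} (f : k ⟶ m) (g : m ⟶ n) :
    tmap hX (f ≫ g) ≅ tmap hX g ≫ tmap hX f :=
  have := evBase_isEquivalence hX n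
  Cat.Hom.isoMk (extendIso (evBase X n) (F := (tmap hX (f ≫ g)).toFunctor)
    (G := (tmap hX g).toFunctor ⋙ (tmap hX f).toFunctor)
    ((transport X hX (f ≫ g)).iso.symm ≪≫
      Functor.isoWhiskerLeft (resOp X g) (transport X hX f).iso ≪≫
      Functor.isoWhiskerRight (transport X hX g).iso (tmap hX f).toFunctor))

/-- Together with `tiso_tmapId`, this characterises the coherence cells: they are what makes `tiso`
compatible with the strict functor `Desc`. -/
theorem tiso_tmapComp {k m n : SimplexCategory} (f : k ⟶ m) (g : m ⟶ n) (x : Desc X n.len) :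
    (tiso hX (f ≫ g) x).hom ≫ (tmapComp hX f g).hom.toNatTrans.app ((evBase X n).obj x) =
      (tiso hX f ((resOp X g).obj x)).hom ≫ (tmap hX f).toFunctor.map (tiso hX g x).hom := by
  have := evBase_isEquivalence hX n
  refine (congrArg (_ ≫ ·) (extendIso_hom_app (evBase X n) _ x)).trans ?_
  exact (tiso hX (f ≫ g) x).hom_inv_id_assoc _

theorem tmapComp_naturality {k m n : SimplexCategory} (f : k ⟶ m) (g : m ⟶ n)
    {x y : lev X n} (φ : x ⟶ y) :
    (tmap hX (f ≫ g)).toFunctor.map φ ≫ (tmapComp hX f g).hom.toNatTrans.app y =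
      (tmapComp hX f g).hom.toNatTrans.app x ≫
        (tmap hX f).toFunctor.map ((tmap hX g).toFunctor.map φ) :=
  (tmapComp hX f g).hom.toNatTrans.naturality φ

theorem app_eq_of_evBase {n : SimplexCategory} {D : Type*} [Category* D] {F G : lev X n ⥤ D}
    (hX : IsColourPreserving X) {σ τ : F ⟶ G}
    (h : ∀ x, σ.app ((evBase X n).obj x) = τ.app ((evBase X n).obj x)) (x : lev X n) :
    σ.app x = τ.app x := by
  have := evBase_isEquivalence hX n
  rw [eq_of_app_eq (evBase X n) h]

theorem tmapComp_assoc {k l m n : SimplexCategory} (f : k ⟶ l) (g : l ⟶ m) (h : m ⟶ n)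
    (x : lev X n) :
    (tmapComp hX f (g ≫ h)).hom.toNatTrans.app x ≫
        (tmap hX f).toFunctor.map ((tmapComp hX g h).hom.toNatTrans.app x) =
      (tmapComp hX (f ≫ g) h).hom.toNatTrans.app x ≫
        (tmapComp hX f g).hom.toNatTrans.app ((tmap hX h).toFunctor.obj x) := by
  refine app_eq_of_evBase hX
    (σ := (tmapComp hX f (g ≫ h)).hom.toNatTrans ≫
      Functor.whiskerRight (tmapComp hX g h).hom.toNatTrans (tmap hX f).toFunctor)
    (τ := (tmapComp hX (f ≫ g) h).hom.toNatTrans ≫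
      Functor.whiskerLeft (tmap hX h).toFunctor (tmapComp hX f g).hom.toNatTrans) ?_ x
  intro y
  change _ ≫ _ = (tmapComp hX (f ≫ g) h).hom.toNatTrans.app _ ≫
    (tmapComp hX f g).hom.toNatTrans.app ((tmap hX h).toFunctor.obj _)
  -- After precomposition both sides become the composite of three `tiso`. The second side needs
  -- naturality of `tmapComp` at `tiso hX h y`.
  refine (cancel_epi (tiso hX (f ≫ g ≫ h) y).hom).1 ?_
  have h1 := tiso_tmapComp hX f (g ≫ h) y
  have h2 := tiso_tmapComp hX (f ≫ g) h y
  have h3 := tiso_tmapComp hX g h y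
  have h4 := tiso_tmapComp hX f g ((resOp X h).obj y)
  have h5 := tmapComp_naturality hX f g (tiso hX h y).hom
  refine ((Category.assoc _ _ _).symm.trans (congrArg (· ≫ _) h1)).trans ?_
  refine Eq.trans ?_ ((Category.assoc _ _ _).symm.trans (congrArg (· ≫ _) h2)).symm
  refine (Category.assoc _ _ _).trans ?_
  refine Eq.trans ?_ ((Category.assoc _ _ _).trans ((congrArg (_ ≫ ·) h5).trans
    ((Category.assoc _ _ _).symm.trans ((congrArg (· ≫ _) h4).trans (Category.assoc _ _ _))))).symm
  refine congrArg (_ ≫ ·) ?_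
  refine (Functor.map_comp _ _ _).symm.trans ?_
  exact (congrArg (tmap hX f).toFunctor.map h3).trans (Functor.map_comp _ _ _)

theorem eqToHom_toNatTrans_app {C D : Cat.{u, u}} {F G : C ⟶ D} (h : F = G) (x : C) :
    (eqToHom h).toNatTrans.app x = eqToHom (by rw [h]) := by
  rw [Cat.Hom₂.eqToHom_toNatTrans, eqToHom_app]

theorem tiso_congr {m n : SimplexCategory} {f g : m ⟶ n} (e : f = g) (x : Desc X n.len) :
    (tiso hX f x).hom ≍ (tiso hX g x).hom := by
  rw [e]

theorem eq_eqToHom_of_comp_heq {C : Type*} [Category* C] {w x y : C} (f : w ⟶ x) [Epi f]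
    (g : x ⟶ y) (h : x = y) (e : f ≫ g ≍ f) : g = eqToHom h := by
  subst h
  rw [← cancel_epi f, eq_of_heq e, eqToHom_refl, Category.comp_id]

theorem tmapComp_id_right {m n : SimplexCategory} (f : m ⟶ n) (x : lev X n) :
    (tmapComp hX f (𝟙 n)).hom.toNatTrans.app x ≫
      (tmap hX f).toFunctor.map ((tmapId hX n).hom.toNatTrans.app x) =
        eqToHom (by rw [Category.comp_id]; rfl) := by
  have e : tmap hX (f ≫ 𝟙 n) = 𝟙 _ ≫ tmap hX f := by rw [Category.comp_id, Category.id_comp]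
  refine (app_eq_of_evBase hX
    (σ := (tmapComp hX f (𝟙 n)).hom.toNatTrans ≫
      Functor.whiskerRight (tmapId hX n).hom.toNatTrans (tmap hX f).toFunctor)
    (τ := (eqToHom e).toNatTrans) ?_ x).trans (eqToHom_toNatTrans_app e x)
  intro y
  refine Eq.trans ?_ (eqToHom_toNatTrans_app e _).symm
  apply eq_eqToHom_of_comp_heq (tiso hX (f ≫ 𝟙 n) y).hom
  refine HEq.trans (heq_of_eq ?_) (tiso_congr hX (Category.comp_id f) y).symm
  refine ((Category.assoc _ _ _).symm.trans (congrArg (· ≫ _) (tiso_tmapComp hX f (𝟙 n) y))).trans ?_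
  refine ((Category.assoc _ _ _).trans (congrArg (_ ≫ ·) ?_)).trans (Category.comp_id _)
  refine (Functor.map_comp _ _ _).symm.trans ?_
  exact (congrArg (tmap hX f).toFunctor.map (tiso_tmapId hX n y)).trans
    (CategoryTheory.Functor.map_id _ _)

theorem tmapComp_id_left {m n : SimplexCategory} (f : m ⟶ n) (x : lev X n) :
    (tmapComp hX (𝟙 m) f).hom.toNatTrans.app x ≫
      (tmapId hX m).hom.toNatTrans.app ((tmap hX f).toFunctor.obj x) =
        eqToHom (by rw [Category.id_comp]; rfl) := by
  have e : tmap hX (𝟙 m ≫ f) = tmap hX f ≫ 𝟙 _ := by rw [Category.comp_id, Category.id_comp]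
  refine (app_eq_of_evBase hX
    (σ := (tmapComp hX (𝟙 m) f).hom.toNatTrans ≫
      Functor.whiskerLeft (tmap hX f).toFunctor (tmapId hX m).hom.toNatTrans)
    (τ := (eqToHom e).toNatTrans) ?_ x).trans (eqToHom_toNatTrans_app e x)
  intro y
  refine Eq.trans ?_ (eqToHom_toNatTrans_app e _).symm
  apply eq_eqToHom_of_comp_heq (tiso hX (𝟙 m ≫ f) y).hom
  refine HEq.trans (heq_of_eq ?_) (tiso_congr hX (Category.id_comp f) y).symm
  refine ((Category.assoc _ _ _).symm.trans (congrArg (· ≫ _) (tiso_tmapComp hX (𝟙 m) f y))).trans ?_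
  have h1 := (tmapId hX m).hom.toNatTrans.naturality (tiso hX f y).hom
  refine (Category.assoc _ _ _).trans ((congrArg (_ ≫ ·) h1).trans ?_)
  refine (Category.assoc _ _ _).symm.trans ?_
  refine (congrArg (· ≫ _) (tiso_tmapId hX m ((resOp X f).obj y))).trans ?_
  exact Category.id_comp _

/-- The pseudo-functor obtained by transporting descent data along evaluation. -/
noncomputable def transportPs : PsFun.{u} :=
  pseudofunctorOfComponents (fun n => lev X n.unop) (fun f => tmap hX f.unop)
    (fun n => tmapId hX n.unop) (fun f g => tmapComp hX g.unop f.unop)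
    (fun f g h x => (tmapComp_assoc hX h.unop g.unop f.unop x).trans (Category.id_comp _).symm)
    (fun f x => tmapComp_id_right hX f.unop x)
    (fun f x => tmapComp_id_left hX f.unop x)

/-! ### Strictness on monomorphisms -/

theorem tmap_mono {m n : SemiSimplexCategory} (f : m ⟶ n) :
    tmap hX (SemiSimplexCategory.toSimplexCategory.map f) = X.map (FatDelta.incl.map f).op :=
  congrArg Transport.map (transport_map X hX f)

theorem comp_heq_comp {C : Type*} [Category* C] {x y z x' y' z' : C} {f : x ⟶ y} {g : y ⟶ z}
    {f' : x' ⟶ y'} {g' : y' ⟶ z'} (hx : x = x') (hy : y = y') (hz : z = z') (hf : f ≍ f')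
    (hg : g ≍ g') : f ≫ g ≍ f' ≫ g' := by
  subst hx hy hz hf hg
  rfl

theorem map_heq_map {C D : Type*} [Category* C] [Category* D] {F G : C ⥤ D} (h : F = G)
    {x y x' y' : C} {f : x ⟶ y} {g : x' ⟶ y'} (hx : x = x') (hy : y = y') (hf : f ≍ g) :
    F.map f ≍ G.map g := by
  subst h hx hy hf
  rfl

/-- The embedding `e` is a variable so that identities and composites of embeddings can be supplied
in the form used by `iso_id` and `iso_comp`. -/
theorem tiso_mono {m n : SemiSimplexCategory} (f : m ⟶ n) {e : Fin (m.len + 1) ↪o Fin (n.len + 1)}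
    (he : SemiSimplexCategory.homEquiv f = e) (x : Desc X n.len) :
    (tiso hX (SemiSimplexCategory.toSimplexCategory.map f) x).hom ≍ (x.iso (embChart e)).hom := by
  subst he
  have key : ∀ (t : Transport X (SemiSimplexCategory.toSimplexCategory.map f))
      (_ : t = monoTransport X f),
      t.iso.hom.app x ≍ (x.iso (embChart (SemiSimplexCategory.homEquiv f))).hom := by
    rintro _ rfl
    rfl
  exact key _ (transport_map X hX f)

theorem eqToHom_of_comp_eqToHom_heq {C : Type*} [Category* C] {w x y w' x' : C} {f : w ⟶ x}
    {g : x ⟶ y} {h : w' = x'} (hw : w = w') (hx : x = x') (hy : y = w) (hf : f ≍ eqToHom h)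
    (e : f ≫ g ≍ 𝟙 w) : g = eqToHom ((hx.trans (h.symm.trans hw.symm)).trans hy.symm) := by
  subst hx h hw hy
  obtain rfl := hf
  exact (Category.id_comp _).symm.trans (eq_of_heq e)

/-- On monomorphisms `tiso` is a structure isomorphism of the descent datum. Its unit and
composition laws hold up to `eqToHom`, so the cells characterised by `tiso` are themselves
`eqToHom`. -/
theorem transportPs_isStrong : (transportPs hX).IsStrong where
  mapId a := by
    have h : tmap hX (𝟙 _) = 𝟙 (lev X ⦋a.unop.len⦌) := by
      refine (tmap_mono hX (𝟙 a.unop)).trans ?_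
      rw [FatDelta.incl.map_id, op_id, X.map_id]
    refine ⟨h, eq_eqToIso _ _ fun x => ?_⟩
    refine (app_eq_of_evBase hX (σ := (tmapId hX ⦋a.unop.len⦌).hom.toNatTrans)
      (τ := (eqToHom h).toNatTrans) ?_ x).trans (eqToHom_toNatTrans_app h x)
    intro y
    refine Eq.trans ?_ (eqToHom_toNatTrans_app h _).symm
    have h1 := (tiso_mono hX (𝟙 a.unop) (SemiSimplexCategory.homEquiv_id _) y).trans
      (heq_of_eq (y.iso_id (Chart.base a.unop.len)))
    exact eqToHom_of_comp_eqToHom_heq rfl (by rw [h, pull_obj_id]; rfl) rfl h1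
      (heq_of_eq (tiso_tmapId hX ⦋a.unop.len⦌ y))
  mapComp {a b c} f g := by
    let f' := SemiSimplexCategory.toSimplexCategory.map f.unop
    let g' := SemiSimplexCategory.toSimplexCategory.map g.unop
    have h : tmap hX (g' ≫ f') = tmap hX f' ≫ tmap hX g' := by
      refine (tmap_mono hX (g.unop ≫ f.unop)).trans ?_
      rw [FatDelta.incl.map_comp, op_comp, X.map_comp, tmap_mono, tmap_mono]
      rfl
    refine ⟨h, eq_eqToIso _ _ fun x => ?_⟩
    refine (app_eq_of_evBase hX (σ := (tmapComp hX g' f').hom.toNatTrans)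
      (τ := (eqToHom h).toNatTrans) ?_ x).trans (eqToHom_toNatTrans_app h x)
    intro y
    refine Eq.trans ?_ (eqToHom_toNatTrans_app h _).symm
    rw [← cancel_epi (tiso hX (g' ≫ f') y).hom]
    refine (tiso_tmapComp hX g' f' y).trans (eq_of_heq ?_)
    have h1 := tiso_mono hX f.unop rfl y
    have h2 := tiso_mono hX g.unop rfl ((resOp X f').obj y)
    have h3 := tiso_mono hX (g.unop ≫ f.unop) (SemiSimplexCategory.homEquiv_comp _ _) y
    have h4 : (tmap hX g').toFunctor = pull X (FatDelta.incl.map g.unop) :=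
      congrArg Cat.Hom.toFunctor (tmap_mono hX g.unop)
    have h4' : (tmap hX f').toFunctor = pull X (FatDelta.incl.map f.unop) :=
      congrArg Cat.Hom.toFunctor (tmap_mono hX f.unop)
    have h5 := y.iso_comp
      (Chart.pushHom (embChart (SemiSimplexCategory.homEquiv g.unop))
        (SemiSimplexCategory.homEquiv f.unop).toOrderHom)
      (embChart (SemiSimplexCategory.homEquiv f.unop))
      (embChart ((SemiSimplexCategory.homEquiv g.unop).trans
        (SemiSimplexCategory.homEquiv f.unop))) rfl
    refine HEq.trans ?_ (comp_eqToHom_heq _ _).symm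
    refine HEq.trans ?_ h3.symm
    refine HEq.trans ?_ (heq_of_eq h5.symm)
    refine comp_heq_comp rfl ?_ ?_ h2 ?_
    · exact Functor.congr_obj h4 _
    · rw [h4, h4']
      exact pull_obj_comp rfl _
    · refine HEq.trans ?_ (comp_eqToHom_heq _ _).symm
      exact map_heq_map h4 rfl (Functor.congr_obj h4' _) h1

end

/-! ### Functoriality of the transported pseudo-functor -/

section

variable {X X' X'' : FatDeltaᵒᵖ ⥤ Cat.{u, u}} (hX : IsColourPreserving X)
  (hX' : IsColourPreserving X') (hX'' : IsColourPreserving X'') (F : X ⟶ X') (F' : X' ⟶ X'')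

/-- The component of a natural transformation at an ordinal without links. -/
abbrev levMap (n : SimplexCategory) : lev X n ⟶ lev X' n :=
  F.app (op (FatDelta.incl.obj ⦋n.len⦌ₛ))

theorem app_pull_obj {k m : FatDelta} (h : k ⟶ m) (x : X.obj (op m)) :
    (F.app (op k)).toFunctor.obj ((pull X h).obj x) =
      (pull X' h).obj ((F.app (op m)).toFunctor.obj x) :=
  Functor.congr_obj congr(($(F.naturality h.op)).toFunctor) x

theorem map_eqToHom_comp_eqToHom {C D : Type*} [Category* C] [Category* D] (G : C ⥤ D) {x y : C}
    {z : D} (h : x = y) (h' : G.obj y = z) :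
    G.map (eqToHom h) ≫ eqToHom h' = eqToHom ((congrArg G.obj h).trans h') := by
  subst h h'
  simp

theorem mapNat_iso_heq {n : ℕ} (x : Desc X n) {c d : Chart n} (h : c ⟶ d) :
    (((Desc.mapNat F n).obj x).iso h).hom ≍ (F.app _).toFunctor.map (x.iso h).hom :=
  comp_eqToHom_heq ((F.app _).toFunctor.map (x.iso h).hom) (app_pull_obj F h.hom _)

theorem mapNat_id_obj {n : ℕ} (x : Desc X n) : (Desc.mapNat (𝟙 X) n).obj x = x := by
  refine Desc.ext rfl (heq_of_eq ?_)
  funext c d h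
  exact Iso.ext (Category.comp_id _)

theorem mapNat_comp_obj {n : ℕ} (x : Desc X n) :
    (Desc.mapNat (F ≫ F') n).obj x = (Desc.mapNat F' n).obj ((Desc.mapNat F n).obj x) := by
  refine Desc.ext rfl (heq_of_eq ?_)
  funext c d h
  apply Iso.ext
  refine Eq.trans ?_ (congrArg (· ≫ _) ((F'.app _).toFunctor.map_comp _ _).symm)
  refine Eq.trans ?_ (Category.assoc _ _ _).symm
  refine congrArg (_ ≫ ·) ?_
  exact (map_eqToHom_comp_eqToHom (F'.app (op c.shape)).toFunctor (app_pull_obj F h.hom _)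
    (app_pull_obj F' h.hom _)).symm

theorem tiso_congr_obj {m n : SimplexCategory} (f : m ⟶ n) {x y : Desc X n.len} (h : x = y) :
    (tiso hX f x).hom ≍ (tiso hX f y).hom := by
  rw [h]

theorem natTrans_heq {C D : Type*} [Category* C] [Category* D] {F G F' G' : C ⥤ D} (hF : F = F')
    (hG : G = G') {α : F ⟶ G} {β : F' ⟶ G'} (h : ∀ c, α.app c ≍ β.app c) : α ≍ β := by
  subst hF hG
  exact heq_of_eq (NatTrans.ext (funext fun c => eq_of_heq (h c)))

/-- The pseudo-naturality constraint of the transported natural transformation. -/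
noncomputable def tnat {m n : SimplexCategory} (f : m ⟶ n) :
    tmap hX f ≫ levMap F m ≅ levMap F n ≫ tmap hX' f :=
  have := evBase_isEquivalence hX n
  Cat.Hom.isoMk (extendIso (evBase X n) (F := (tmap hX f).toFunctor ⋙ (levMap F m).toFunctor)
    (G := (levMap F n).toFunctor ⋙ (tmap hX' f).toFunctor)
    ((Functor.isoWhiskerRight (transport X hX f).iso (levMap F m).toFunctor).symm ≪≫
      Functor.isoWhiskerLeft (Desc.mapNat F n.len) (transport X' hX' f).iso))

/-- This equation characterises `tnat`. It makes sense because `Desc.mapNat` commutes strictly with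
restriction and with evaluation. -/
theorem tiso_tnat {m n : SimplexCategory} (f : m ⟶ n) (x : Desc X n.len) :
    (levMap F m).toFunctor.map (tiso hX f x).hom ≫
      (tnat hX hX' F f).hom.toNatTrans.app ((evBase X n).obj x) =
        (tiso hX' f ((Desc.mapNat F n.len).obj x)).hom := by
  have := evBase_isEquivalence hX n
  refine (congrArg ((levMap F m).toFunctor.map (tiso hX f x).hom ≫ ·)
    (extendIso_hom_app (evBase X n) _ x)).trans ?_
  refine (Category.assoc ((levMap F m).toFunctor.map (tiso hX f x).hom)
    ((levMap F m).toFunctor.map (tiso hX f x).inv) _).symm.trans ?_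
  have h : (levMap F m).toFunctor.map (tiso hX f x).hom ≫
      (levMap F m).toFunctor.map (tiso hX f x).inv = 𝟙 _ := by
    rw [← Functor.map_comp, Iso.hom_inv_id, CategoryTheory.Functor.map_id]
  exact (congrArg (· ≫ (tiso hX' f ((Desc.mapNat F n.len).obj x)).hom) h).trans
    (Category.id_comp _)

theorem tnat_id (n : SimplexCategory) (x : lev X n) :
    (tnat hX hX' F (𝟙 n)).hom.toNatTrans.app x ≫
        (tmapId hX' n).hom.toNatTrans.app ((levMap F n).toFunctor.obj x) =
      (levMap F n).toFunctor.map ((tmapId hX n).hom.toNatTrans.app x) := by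
  refine app_eq_of_evBase hX
    (σ := (tnat hX hX' F (𝟙 n)).hom.toNatTrans ≫
      Functor.whiskerLeft (levMap F n).toFunctor (tmapId hX' n).hom.toNatTrans)
    (τ := Functor.whiskerRight (tmapId hX n).hom.toNatTrans (levMap F n).toFunctor) ?_ x
  intro y
  refine (cancel_epi ((levMap F n).toFunctor.map (tiso hX (𝟙 n) y).hom)).1 ?_
  refine ((Category.assoc _ _ _).symm.trans
    (congrArg (· ≫ _) (tiso_tnat hX hX' F (𝟙 n) y))).trans ?_
  refine (tiso_tmapId hX' n ((Desc.mapNat F n.len).obj y)).trans (Eq.symm ?_)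
  refine ((levMap F _).toFunctor.map_comp _ _).symm.trans ?_
  exact (congrArg (levMap F n).toFunctor.map (tiso_tmapId hX n y)).trans
    (CategoryTheory.Functor.map_id _ _)

theorem tnat_comp {k m n : SimplexCategory} (f : k ⟶ m) (g : m ⟶ n) (x : lev X n) :
    (tnat hX hX' F (f ≫ g)).hom.toNatTrans.app x ≫
        (tmapComp hX' f g).hom.toNatTrans.app ((levMap F n).toFunctor.obj x) =
      (levMap F k).toFunctor.map ((tmapComp hX f g).hom.toNatTrans.app x) ≫
        (tnat hX hX' F f).hom.toNatTrans.app ((tmap hX g).toFunctor.obj x) ≫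
        (tmap hX' f).toFunctor.map ((tnat hX hX' F g).hom.toNatTrans.app x) := by
  refine app_eq_of_evBase hX
    (σ := (tnat hX hX' F (f ≫ g)).hom.toNatTrans ≫
      Functor.whiskerLeft (levMap F n).toFunctor (tmapComp hX' f g).hom.toNatTrans)
    (τ := Functor.whiskerRight (tmapComp hX f g).hom.toNatTrans (levMap F k).toFunctor ≫
      Functor.whiskerLeft (tmap hX g).toFunctor (tnat hX hX' F f).hom.toNatTrans ≫
      Functor.whiskerRight (tnat hX hX' F g).hom.toNatTrans (tmap hX' f).toFunctor) ?_ x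
  intro y
  refine (cancel_epi ((levMap F k).toFunctor.map (tiso hX (f ≫ g) y).hom)).1 ?_
  refine ((Category.assoc _ _ _).symm.trans
    (congrArg (· ≫ _) (tiso_tnat hX hX' F (f ≫ g) y))).trans ?_
  refine (tiso_tmapComp hX' f g ((Desc.mapNat F n.len).obj y)).trans (Eq.symm ?_)
  refine (Category.assoc _ _ _).symm.trans ?_
  refine (congrArg (· ≫ _) (((levMap F k).toFunctor.map_comp _ _).symm.trans
    ((congrArg (levMap F k).toFunctor.map (tiso_tmapComp hX f g y)).trans
      ((levMap F k).toFunctor.map_comp _ _)))).trans ?_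
  refine (Category.assoc _ _ _).trans ?_
  refine (congrArg (_ ≫ ·) ((Category.assoc _ _ _).symm.trans (congrArg (· ≫ _)
    ((tnat hX hX' F f).hom.toNatTrans.naturality (tiso hX g y).hom)))).trans ?_
  refine (congrArg (_ ≫ ·) (Category.assoc _ _ _)).trans ?_
  refine (Category.assoc _ _ _).symm.trans ?_
  refine (congrArg (· ≫ _) (tiso_tnat hX hX' F f ((resOp X g).obj y))).trans ?_
  refine congrArg (_ ≫ ·) ?_
  refine ((tmap hX' f).toFunctor.map_comp _ _).symm.trans ?_
  exact congrArg (tmap hX' f).toFunctor.map (tiso_tnat hX hX' F g y)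

/-- The transported natural transformation. -/
noncomputable def transportTrans :
    Pseudofunctor.StrongTrans (transportPs hX) (transportPs hX') :=
  strongTransOfComponents (fun n => levMap F n.as.unop) (fun f => tnat hX hX' F f.as.unop)
    (fun n x => tnat_id hX hX' F n.as.unop x)
    (fun f g x => tnat_comp hX hX' F g.as.unop f.as.unop x)

theorem transportTrans_isStrong : IsStrongTrans (transportTrans hX hX' F) where
  naturality {a b} f := by
    let f' := SemiSimplexCategory.toSimplexCategory.map f.unop
    have h : tmap hX f' ≫ levMap F _ = levMap F _ ≫ tmap hX' f' := by
      rw [tmap_mono, tmap_mono]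
      exact F.naturality _
    refine ⟨h, eq_eqToIso _ _ fun x => ?_⟩
    refine (app_eq_of_evBase hX (σ := (tnat hX hX' F f').hom.toNatTrans)
      (τ := (eqToHom h).toNatTrans) ?_ x).trans (eqToHom_toNatTrans_app h x)
    intro y
    refine Eq.trans ?_ (eqToHom_toNatTrans_app h _).symm
    rw [← cancel_epi ((levMap F _).toFunctor.map (tiso hX f' y).hom)]
    refine (tiso_tnat hX hX' F f' y).trans (eq_of_heq ?_)
    refine HEq.trans ?_ (comp_eqToHom_heq _ _).symm
    refine (tiso_mono hX' f.unop rfl _).trans ?_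
    refine (mapNat_iso_heq F y _).trans ?_
    refine map_heq_map rfl rfl ?_ (tiso_mono hX f.unop rfl y).symm
    exact (Functor.congr_obj (congrArg Cat.Hom.toFunctor (tmap_mono hX f.unop)) _).symm

theorem transportTrans_id : transportTrans hX hX (𝟙 X) = Pseudofunctor.StrongTrans.id _ := by
  refine strongTrans_ext _ _ rfl fun {a b} f x => heq_of_eq ?_
  refine Eq.trans ?_ (id_naturality_app (transportPs hX) f x).symm
  refine app_eq_of_evBase hX (σ := (tnat hX hX (𝟙 X) f.as.unop).hom.toNatTrans)
    (τ := 𝟙 (tmap hX f.as.unop).toFunctor) ?_ x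
  intro y
  refine (cancel_epi (tiso hX f.as.unop y).hom).1 ?_
  refine (tiso_tnat hX hX (𝟙 X) f.as.unop y).trans ?_
  refine Eq.trans ?_ (Category.comp_id _).symm
  exact eq_of_heq (tiso_congr_obj hX f.as.unop (mapNat_id_obj y))

theorem transportTrans_comp : transportTrans hX hX'' (F ≫ F') =
    (transportTrans hX hX' F).vcomp (transportTrans hX' hX'' F') := by
  refine strongTrans_ext _ _ rfl fun {a b} f x => heq_of_eq ?_
  refine Eq.trans ?_ (vcomp_naturality_app (transportTrans hX hX' F)
    (transportTrans hX' hX'' F') f x).symm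
  refine app_eq_of_evBase hX (σ := (tnat hX hX'' (F ≫ F') f.as.unop).hom.toNatTrans)
    (τ := Functor.whiskerRight (tnat hX hX' F f.as.unop).hom.toNatTrans (levMap F' _).toFunctor ≫
      Functor.whiskerLeft (levMap F _).toFunctor (tnat hX' hX'' F' f.as.unop).hom.toNatTrans) ?_ x
  intro y
  refine (cancel_epi ((levMap (F ≫ F') _).toFunctor.map (tiso hX f.as.unop y).hom)).1 ?_
  refine (tiso_tnat hX hX'' (F ≫ F') f.as.unop y).trans (Eq.symm ?_)
  refine (Category.assoc _ _ _).symm.trans ?_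
  refine (congrArg (· ≫ _) ((Functor.map_comp _ _ _).symm.trans
    (congrArg (levMap F' _).toFunctor.map (tiso_tnat hX hX' F f.as.unop y)))).trans ?_
  refine (tiso_tnat hX' hX'' F' f.as.unop ((Desc.mapNat F _).obj y)).trans ?_
  exact eq_of_heq (tiso_congr_obj hX'' f.as.unop (mapNat_comp_obj F F' y)).symm

end

/-- The functor from fair 2-categories to strong Segalic pseudo-functors, given the proof of
the Segal condition. -/
noncomputable def transportFunctor
    (H : ∀ X : FairCat.{u}, (transportPs (X := X.obj) X.property.isColourPreserving).IsSegalic) :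
    FairCat.{u} ⥤ SSegPs.{u} where
  obj X := ⟨transportPs X.property.isColourPreserving, H X, transportPs_isStrong _⟩
  map F := ⟨transportTrans _ _ F.hom, transportTrans_isStrong _ _ _⟩
  map_id _ := SSegPs.Hom.ext (transportTrans_id _)
  map_comp _ _ := SSegPs.Hom.ext (transportTrans_comp _ _ _ _ _)

theorem transportFunctor_restrict
    (H : ∀ X : FairCat.{u}, (transportPs (X := X.obj) X.property.isColourPreserving).IsSegalic) :
    transportFunctor H ⋙ SSegPs.restrict = FairCat.restrict := by
  have hobj : ∀ X : FairCat.{u}, SSegPs.restrict.obj ((transportFunctor H).obj X) =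
      FairCat.restrict.obj X := by
    intro X
    refine Functor.hext (fun _ => rfl) fun a b f => ?_
    change tmap X.property.isColourPreserving _ ≍ X.obj.map _
    apply heq_of_eq
    exact tmap_mono X.property.isColourPreserving f.unop
  refine Functor.hext hobj fun X Y F => natTrans_heq (hobj X) (hobj Y) fun a => ?_
  rfl

/-! ### The comparison with the original functor -/

section

theorem FatDelta.eqToHom_toEmb_val {k m : FatDelta} (h : k = m) (i : Fin (k.len + 1)) :
    ((eqToHom h : k ⟶ m).toEmb i).val = i.val := by
  subst h
  rfl

theorem FatDelta.component_val {k : FatDelta} (h : k.links = ∅) (i : Fin (k.len + 1)) :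
    (k.component i).val = i.val := by
  change k.below i = i.val
  unfold FatDelta.below
  rw [h, Finset.compl_empty]
  exact (Fin.card_filter_val_lt (n := k.len) (m := i.val)).trans
    (min_eq_right (Nat.le_of_lt_succ i.2))

/-- The equality is not definitional, as the number of uncoloured edges is a cardinality; hence the
`eqToHom` in the comparison at ordinals without links. -/
theorem FatDelta.incl_proj {k : FatDelta} (h : k.links = ∅) :
    k = FatDelta.incl.obj ⦋(FatDelta.proj.obj k).len⦌ₛ := by
  obtain ⟨L, S⟩ := k
  obtain rfl : S = ∅ := h
  change FatDelta.mk L ∅ = FatDelta.mk (Finset.card (∅ : Finset (Fin L))ᶜ) ∅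
  rw [Finset.compl_empty, Finset.card_univ, Fintype.card_fin]

/-- The map of charts from an ordinal without links to the base chart. -/
noncomputable def linkFreeChart {k : FatDelta} (h : k.links = ∅) :
    Chart.ofShape k ⟶ Chart.base (FatDelta.proj.obj k).len where
  hom := eqToHom (FatDelta.incl_proj h)
  w i := Fin.ext ((FatDelta.eqToHom_toEmb_val (FatDelta.incl_proj h) i).trans
    (FatDelta.component_val h i).symm)

/-- The map of charts given by a map of coloured semi-ordinals. -/
noncomputable def shapeChart {k m : FatDelta} (h : k ⟶ m) {f : FatDelta.proj.obj k ⟶ FatDelta.proj.obj m}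
    (e : f = FatDelta.proj.map h) :
    (Chart.ofShape k).push f.toOrderHom ⟶ Chart.ofShape m where
  hom := h
  w i := by
    subst e
    exact (FatDelta.componentMap_component h i).symm

variable (X : FatDeltaᵒᵖ ⥤ Cat.{u, u})

/-- Evaluation of descent data at the chart of components. -/
noncomputable def evShape (k : FatDelta) : Desc X (FatDelta.proj.obj k).len ⥤ X.obj (op k) :=
  Desc.ev X (Chart.ofShape k)

/-- A functor corresponding to evaluation at `k` under evaluation at the base. -/
structure Comparison (k : FatDelta) : Type u where
  map : lev X (FatDelta.proj.obj k) ⟶ X.obj (op k)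
  iso : evShape X k ≅ evBase X (FatDelta.proj.obj k) ⋙ map.toFunctor

variable {X} (hX : IsColourPreserving X)

open Classical in
/-- A choice of comparison functors, which are identities at the ordinals without links. -/
noncomputable def comparison (k : FatDelta) : Comparison X k :=
  if h : k.links = ∅ then
    { map := X.map (linkFreeChart h).hom.op
      iso := Desc.evIso (linkFreeChart h) }
  else
    have := evBase_isEquivalence hX (FatDelta.proj.obj k)
    { map := ((evBase X _).inv ⋙ evShape X k).toCatHom
      iso := (Functor.leftUnitor _).symm ≪≫
        Functor.isoWhiskerRight (evBase X _).asEquivalence.unitIso _ ≪≫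
        Functor.associator _ _ _ }

/-- The comparison functor. -/
noncomputable abbrev cmp (k : FatDelta) : lev X (FatDelta.proj.obj k) ⟶ X.obj (op k) :=
  (comparison hX k).map

/-- The structure isomorphism of the comparison functor. -/
noncomputable abbrev cmpIso (k : FatDelta) (y : Desc X (FatDelta.proj.obj k).len) :
    (evShape X k).obj y ≅ (cmp hX k).toFunctor.obj ((evBase X _).obj y) :=
  (comparison hX k).iso.app y

theorem cmp_linkFree (k : FatDelta) (h : k.links = ∅) :
    cmp hX k = eqToHom (congrArg (fun l => X.obj (op l)) (FatDelta.incl_proj h).symm) := by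
  have e : (comparison hX k).map = X.map (linkFreeChart h).hom.op := by
    unfold comparison
    rw [dif_pos h]
    rfl
  refine e.trans ?_
  change X.map (eqToHom (FatDelta.incl_proj h)).op = _
  rw [eqToHom_op, eqToHom_map]

/-- Two out of three: evaluation at the exact chart of components and evaluation at the base are
both equivalences. -/
theorem cmp_isEquivalence (k : FatDelta) : (cmp hX k).toFunctor.IsEquivalence := by
  have h1 := evBase_isEquivalence hX (FatDelta.proj.obj k)
  have h2 : (evShape X k).IsEquivalence :=
    Desc.ev_isEquivalence hX (Chart.ofShape_isExact k)
  have h3 : (evBase X (FatDelta.proj.obj k) ⋙ (cmp hX k).toFunctor).IsEquivalence :=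
    Functor.isEquivalence_of_iso (comparison hX k).iso
  exact Functor.isEquivalence_of_comp_left (evBase X _) (cmp hX k).toFunctor

/-- The naturality constraint of the comparison. -/
noncomputable def cmpNat {k m : FatDelta} (h : k ⟶ m) :
    tmap hX (FatDelta.proj.map h) ≫ cmp hX k ≅ cmp hX m ≫ X.map h.op :=
  have := evBase_isEquivalence hX (FatDelta.proj.obj m)
  Cat.Hom.isoMk (extendIso (evBase X (FatDelta.proj.obj m))
    (F := (tmap hX (FatDelta.proj.map h)).toFunctor ⋙ (cmp hX k).toFunctor)
    (G := (cmp hX m).toFunctor ⋙ pull X h)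
    -- On a datum `y`: return to its restriction along `π h`, evaluate that at `k`, apply the
    -- structure map of `y` over `h`, and compare at `m`.
    ((Functor.isoWhiskerRight (transport X hX (FatDelta.proj.map h)).iso (cmp hX k).toFunctor).symm
      ≪≫ Functor.isoWhiskerLeft (resOp X (FatDelta.proj.map h)) (comparison hX k).iso.symm ≪≫
      Desc.evIso (shapeChart h rfl) ≪≫
      Functor.isoWhiskerRight (comparison hX m).iso (pull X h)))

/-- Allowing any `f` equal to `proj.map h` is needed since `proj` preserves identities and
composites only propositionally. -/
theorem cmpNat_spec {k m : FatDelta} (h : k ⟶ m) {f : FatDelta.proj.obj k ⟶ FatDelta.proj.obj m}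
    (e : f = FatDelta.proj.map h) (y : Desc X (FatDelta.proj.obj m).len) :
    (cmpIso hX k ((resOp X f).obj y)).hom ≫ (cmp hX k).toFunctor.map ((tiso hX f y).hom ≫
      eqToHom (by rw [e])) ≫ (cmpNat hX h).hom.toNatTrans.app ((evBase X _).obj y) =
    (y.iso (shapeChart h e)).hom ≫ (pull X h).map (cmpIso hX m y).hom := by
  subst e
  have := evBase_isEquivalence hX (FatDelta.proj.obj m)
  have h1 := extendIso_hom_app (evBase X (FatDelta.proj.obj m))
    (F := (tmap hX (FatDelta.proj.map h)).toFunctor ⋙ (cmp hX k).toFunctor)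
    (G := (cmp hX m).toFunctor ⋙ pull X h)
    ((Functor.isoWhiskerRight (transport X hX (FatDelta.proj.map h)).iso (cmp hX k).toFunctor).symm
      ≪≫ Functor.isoWhiskerLeft (resOp X (FatDelta.proj.map h)) (comparison hX k).iso.symm ≪≫
      Desc.evIso (shapeChart h rfl) ≪≫
      Functor.isoWhiskerRight (comparison hX m).iso (pull X h)) y
  have h2 : (cmpNat hX h).hom.toNatTrans.app ((evBase X _).obj y) =
    (cmp hX k).toFunctor.map (tiso hX (FatDelta.proj.map h) y).inv ≫
      (cmpIso hX k ((resOp X (FatDelta.proj.map h)).obj y)).inv ≫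
      (y.iso (shapeChart h rfl)).hom ≫ (pull X h).map (cmpIso hX m y).hom := h1
  rw [h2, eqToHom_refl, Category.comp_id, ← Functor.map_comp_assoc, Iso.hom_inv_id,
    CategoryTheory.Functor.map_id, Category.id_comp, Iso.hom_inv_id_assoc]
  rfl

theorem cmpNat_spec_self {k m : FatDelta} (h : k ⟶ m) (y : Desc X (FatDelta.proj.obj m).len) :
    (cmpIso hX k ((resOp X (FatDelta.proj.map h)).obj y)).hom ≫
      (cmp hX k).toFunctor.map (tiso hX (FatDelta.proj.map h) y).hom ≫
        (cmpNat hX h).hom.toNatTrans.app ((evBase X _).obj y) =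
    (y.iso (shapeChart h rfl)).hom ≫ (pull X h).map (cmpIso hX m y).hom := by
  have := cmpNat_spec hX h rfl y
  rwa [eqToHom_refl, Category.comp_id] at this

theorem map₂_app {B : Type*} [Category* B] (P : LocallyDiscrete B ⥤ᵖ Cat.{u, u})
    {a b : LocallyDiscrete B} {f g : a ⟶ b} (η : f ⟶ g) (x : P.obj a) :
    (P.map₂ η).toNatTrans.app x =
      eqToHom (by obtain rfl := obj_ext_of_isDiscrete η; rfl) := by
  obtain rfl := obj_ext_of_isDiscrete η
  obtain rfl : η = 𝟙 f := Subsingleton.elim _ _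
  rw [P.map₂_id]
  rfl

theorem unit_chase {A C : Type*} [Category* A] [Category* C] (G : A ⥤ C) {x z : C} {a₀ a₁ a₂ : A}
    (c : x ≅ G.obj a₀) (t : a₀ ≅ a₁) (q' : a₁ ⟶ a₂) (q : a₂ ⟶ a₁)
    (τ : a₁ ⟶ a₀) (ν : G.obj a₂ ⟶ z) (p : z ⟶ G.obj a₀) {i : x ⟶ z} (hq : q ≫ q' = 𝟙 _)
    (hq' : q' ≫ q = 𝟙 _) (h₁ : c.hom ≫ G.map (t.hom ≫ q') ≫ ν = i) (h₂ : t.hom ≫ τ = 𝟙 _)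
    (h₃ : i ≫ p = c.hom) :
    ν ≫ p = G.map (q ≫ τ) := by
  have : IsIso q' := ⟨q, hq', hq⟩
  rw [← cancel_epi (G.map (t.hom ≫ q')), ← cancel_epi c.hom, ← Functor.map_comp, Category.assoc,
    ← Category.assoc q', hq', Category.id_comp, h₂, CategoryTheory.Functor.map_id,
    Category.comp_id, ← Category.assoc (G.map _), ← Category.assoc c.hom, h₁, h₃]

/-- The composition law as a chase in bare categories, as in `unit_chase` for the unit law.
Transports along equalities become a pair of inverse maps `q`, `q'`, and both sides are compared
after the isomorphisms `c` and `G.map (t.hom ≫ q')`. -/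
theorem comp_chase {A C D : Type*} [Category* A] [Category* C] [Category* D] (G : A ⥤ C)
    (P : D ⥤ C) {x z w : C} {a₀ a₁ a₂ a₃ a₄ : A} {d₀ d₁ d₂ d₃ d₄ : D}
    (c : x ≅ G.obj a₀) (t : a₀ ≅ a₁) (q' : a₁ ⟶ a₂) (q : a₂ ⟶ a₁)
    (τ : a₁ ⟶ a₃) (t₁ : a₀ ⟶ a₄) (t₂ : a₄ ⟶ a₃) (ν : G.obj a₂ ⟶ z) (p : z ⟶ P.obj d₄)
    (i₁ : x ⟶ P.obj d₀) (i₂ : d₀ ⟶ d₁) (r : P.obj d₁ ⟶ w) (m : w ⟶ z) (m' : d₁ ⟶ d₄)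
    (c' : d₀ ⟶ d₂) (t₃ : d₂ ⟶ d₃) (ν₂ : d₃ ⟶ d₄) (ν₁' : G.obj a₄ ⟶ P.obj d₂)
    (ν₁ : G.obj a₃ ⟶ P.obj d₃) {i : x ⟶ w} (hq : q ≫ q' = 𝟙 _) (hq' : q' ≫ q = 𝟙 _)
    (h₁ : c.hom ≫ G.map (t.hom ≫ q') ≫ ν = i ≫ m) (h₂ : i = i₁ ≫ P.map i₂ ≫ r)
    (h₃ : t.hom ≫ τ = t₁ ≫ t₂) (h₄ : c.hom ≫ G.map t₁ ≫ ν₁' = i₁ ≫ P.map c')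
    (h₅ : c' ≫ t₃ ≫ ν₂ = i₂ ≫ m') (h₆ : G.map t₂ ≫ ν₁ = ν₁' ≫ P.map t₃)
    (h₇ : P.map m' = r ≫ m ≫ p) :
    ν ≫ p = G.map (q ≫ τ) ≫ ν₁ ≫ P.map ν₂ := by
  have : IsIso q' := ⟨q, hq', hq⟩
  have e₁ : c.hom ≫ G.map (t.hom ≫ q') ≫ ν ≫ p = i₁ ≫ P.map (c' ≫ t₃ ≫ ν₂) := by
    rw [h₅, P.map_comp, h₇, ← Category.assoc (G.map _), ← Category.assoc c.hom, h₁, h₂]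
    simp only [Category.assoc]
  have e₂ : c.hom ≫ G.map (t.hom ≫ q') ≫ G.map (q ≫ τ) ≫ ν₁ ≫ P.map ν₂ =
      i₁ ≫ P.map (c' ≫ t₃ ≫ ν₂) := by
    rw [← Functor.map_comp_assoc, Category.assoc, ← Category.assoc q', hq', Category.id_comp, h₃,
      Functor.map_comp_assoc, ← Category.assoc (G.map t₂), h₆, Category.assoc, P.map_comp,
      P.map_comp, ← Category.assoc (G.map t₁), ← Category.assoc c.hom, h₄]
    simp only [Category.assoc]
  exact (cancel_epi (G.map (t.hom ≫ q'))).1 ((cancel_epi c.hom).1 (e₁.trans e₂.symm))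

theorem cmpNat_id (k : FatDelta) (x : lev X (FatDelta.proj.obj k)) :
    (cmpNat hX (𝟙 k)).hom.toNatTrans.app x ≫
        eqToHom (pull_obj_id ((cmp hX k).toFunctor.obj x)) =
      (cmp hX k).toFunctor.map (eqToHom (by rw [FatDelta.proj.map_id]) ≫
        (tmapId hX (FatDelta.proj.obj k)).hom.toNatTrans.app x) := by
  have e := FatDelta.proj.map_id k
  have e' : pull X (𝟙 k) = 𝟭 _ := by
    rw [pull, op_id, X.map_id]
    rfl
  refine (congrArg (_ ≫ ·) (eqToHom_app e' _).symm).trans ((app_eq_of_evBase hX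
    (σ := (cmpNat hX (𝟙 k)).hom.toNatTrans ≫
      Functor.whiskerLeft (cmp hX k).toFunctor (eqToHom e'))
    (τ := Functor.whiskerRight ((eqToHom (congrArg (tmap hX) e)).toNatTrans ≫
      (tmapId hX (FatDelta.proj.obj k)).hom.toNatTrans) (cmp hX k).toFunctor) ?_ x).trans
    (congrArg (cmp hX k).toFunctor.map (congrArg (· ≫ _) (eqToHom_toNatTrans_app _ _))))
  intro y
  refine (congrArg (_ ≫ ·) (eqToHom_app e' _)).trans (Eq.trans ?_
    (congrArg (cmp hX k).toFunctor.map (congrArg (· ≫ _) (eqToHom_toNatTrans_app _ _))).symm)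
  have h1 := cmpNat_spec hX (𝟙 k) e.symm y
  have h2 : (y.iso (shapeChart (𝟙 k) e.symm)).hom = _ := y.iso_id (Chart.ofShape k)
  have h3 := tiso_tmapId hX (FatDelta.proj.obj k) y
  have h4 : (eqToHom (pull_obj_id _).symm ≫ (pull X (𝟙 k)).map (cmpIso hX k y).hom) ≫
      eqToHom (pull_obj_id _) = (cmpIso hX k y).hom := by
    rw [pull_map_id]
    simp
  exact unit_chase (cmp hX k).toFunctor (cmpIso hX k y) (tiso hX (𝟙 _) y) _ _ _ _ _
    (eqToHom_trans _ _) (eqToHom_trans _ _)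
    (h1.trans (congrArg (· ≫ _) h2)) h3 h4

theorem cmpNat_comp {k l m : FatDelta} (h : k ⟶ l) (h' : l ⟶ m)
    (x : lev X (FatDelta.proj.obj m)) :
    (cmpNat hX (h ≫ h')).hom.toNatTrans.app x ≫
        eqToHom (pull_obj_comp rfl ((cmp hX m).toFunctor.obj x)).symm =
      (cmp hX k).toFunctor.map (eqToHom (by rw [FatDelta.proj.map_comp]) ≫
        (tmapComp hX (FatDelta.proj.map h) (FatDelta.proj.map h')).hom.toNatTrans.app x) ≫
      (cmpNat hX h).hom.toNatTrans.app ((tmap hX (FatDelta.proj.map h')).toFunctor.obj x) ≫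
      (pull X h).map ((cmpNat hX h').hom.toNatTrans.app x) := by
  have e := FatDelta.proj.map_comp h h'
  have e' : pull X (h ≫ h') = pull X h' ⋙ pull X h := by
    rw [pull, op_comp, X.map_comp]
    rfl
  refine (congrArg (_ ≫ ·) (eqToHom_app e' _).symm).trans ((app_eq_of_evBase hX
    (σ := (cmpNat hX (h ≫ h')).hom.toNatTrans ≫
      Functor.whiskerLeft (cmp hX m).toFunctor (eqToHom e'))
    (τ := Functor.whiskerRight ((eqToHom (congrArg (tmap hX) e)).toNatTrans ≫
      (tmapComp hX (FatDelta.proj.map h) (FatDelta.proj.map h')).hom.toNatTrans)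
        (cmp hX k).toFunctor ≫
      Functor.whiskerLeft (tmap hX (FatDelta.proj.map h')).toFunctor
        (cmpNat hX h).hom.toNatTrans ≫
      Functor.whiskerRight (cmpNat hX h').hom.toNatTrans (pull X h)) ?_ x).trans
    (congrArg (· ≫ _) (congrArg (cmp hX k).toFunctor.map
      (congrArg (· ≫ _) (eqToHom_toNatTrans_app _ _)))))
  intro y
  refine (congrArg (_ ≫ ·) (eqToHom_app e' _)).trans (Eq.trans ?_
    (congrArg (· ≫ _) (congrArg (cmp hX k).toFunctor.map (congrArg (· ≫ _)
      (eqToHom_toNatTrans_app _ _)))).symm)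
  have h1 := cmpNat_spec hX (h ≫ h') e.symm y
  have h2 := y.iso_comp (Chart.pushHom (shapeChart h rfl) (FatDelta.proj.map h').toOrderHom)
    (shapeChart h' rfl) (shapeChart (h ≫ h') e.symm) rfl
  have h3 := tiso_tmapComp hX (FatDelta.proj.map h) (FatDelta.proj.map h') y
  have h4 := cmpNat_spec_self hX h ((resOp X (FatDelta.proj.map h')).obj y)
  have h5 := cmpNat_spec_self hX h' y
  have h6 := (cmpNat hX h).hom.toNatTrans.naturality (tiso hX (FatDelta.proj.map h') y).hom
  have h7 := pull_map_comp (X := X) (rfl : h ≫ h' = h ≫ h') (cmpIso hX m y).hom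
  exact comp_chase (cmp hX k).toFunctor (pull X h)
    (cmpIso hX k ((resOp X _).obj y)) (tiso hX _ y) _ _ _ _ _ _ _ _ _ _ _ _ _ _ _ _ _
    (eqToHom_trans _ _) (eqToHom_trans _ _) h1 h2 h3 h4 h5 h6 h7

/-- The comparison with the original functor. -/
noncomputable def comparisonTrans :
    Pseudofunctor.StrongTrans (FatDelta.proj.op.toPseudofunctor.comp (transportPs hX))
      X.toPseudofunctor' :=
  strongTransOfComponents (fun k => cmp hX k.as.unop) (fun h => cmpNat hX h.as.unop)
    (fun k x => by
      refine Eq.trans ?_ ((cmpNat_id hX k.as.unop x).trans ?_)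
      · refine congrArg (_ ≫ ·) ?_
        exact eqToHom_toNatTrans_app (F := X.toPseudofunctor'.map (𝟙 k)) (G := 𝟙 _)
          (X.map_id k.as) _
      · refine congrArg (cmp hX k.as.unop).toFunctor.map (congrArg (· ≫ _) ?_)
        exact (map₂_app (transportPs hX) (FatDelta.proj.op.toPseudofunctor.mapId k).hom x).symm)
    (fun f g x => by
      refine Eq.trans ?_ ((cmpNat_comp hX g.as.unop f.as.unop x).trans ?_)
      · refine congrArg (_ ≫ ·) ?_
        exact eqToHom_toNatTrans_app (F := X.toPseudofunctor'.map (f ≫ g))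
          (G := X.toPseudofunctor'.map f ≫ X.toPseudofunctor'.map g) (X.map_comp f.as g.as) _
      · refine congrArg (· ≫ _) ?_
        refine congrArg (cmp hX _).toFunctor.map (congrArg (· ≫ _) ?_)
        exact (map₂_app (transportPs hX)
          (FatDelta.proj.op.toPseudofunctor.mapComp f g).hom x).symm)

end

/-! ### The Segal condition -/

namespace FatDelta

theorem hom_ext_apply {k m : FatDelta} {f g : k ⟶ m} (h : ∀ i, f.toEmb i = g.toEmb i) : f = g :=
  FatDelta.Hom.ext (RelEmbedding.ext h)

/-- A strictly monotone map from an ordinal without links. -/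
def ofStrictMono {n : ℕ} {m : FatDelta} (h : Fin (n + 1) → Fin (m.len + 1)) (hh : StrictMono h) :
    incl.obj ⦋n⦌ₛ ⟶ m where
  toEmb := OrderEmbedding.ofStrictMono h hh
  coloured i j hij := by
    obtain rfl : i = j := (Chart.base n).contracts i j hij
    exact ⟨le_rfl, fun e h1 h2 =>
      absurd ((Fin.castSucc_lt_succ (i := e)).trans_le (h2.trans h1)) (lt_irrefl _)⟩

/-- The edge `j → j + 1` of the ordinal `[n]`. -/
def edge {n : ℕ} (j : Fin n) : incl.obj ⦋1⦌ₛ ⟶ incl.obj ⦋n⦌ₛ :=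
  ofStrictMono (m := incl.obj ⦋n⦌ₛ) ![j.castSucc, j.succ] (by
    rw [Fin.strictMono_iff_lt_succ]
    intro i
    obtain rfl := Subsingleton.elim i 0
    exact Fin.castSucc_lt_succ)

/-- The inclusion of `[n]` in `[n + 1]` as an initial segment. -/
def initial (n : ℕ) : incl.obj ⦋n⦌ₛ ⟶ incl.obj ⦋n + 1⦌ₛ :=
  ofStrictMono (m := incl.obj ⦋n + 1⦌ₛ) Fin.castSucc Fin.strictMono_castSucc

theorem lastCases_strictMono {n : ℕ} {α : Type*} [Preorder α] {f : Fin (n + 1) → α} {a : α}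
    (hf : StrictMono f) (ha : f (Fin.last n) < a) :
    StrictMono (Fin.lastCases a f : Fin (n + 1 + 1) → α) := by
  intro i j hij
  induction i using Fin.lastCases with
  | last => exact absurd hij (not_lt.2 (Fin.le_last j))
  | cast i =>
    dsimp only
    rw [Fin.lastCases_castSucc]
    induction j using Fin.lastCases with
    | last =>
      rw [Fin.lastCases_last]
      exact (hf.monotone (Fin.le_last i)).trans_lt ha
    | cast j =>
      rw [Fin.lastCases_castSucc]
      exact hf hij

/-- Gluing of a map from `[n]` with an edge starting at the image of the last vertex. -/
def glue {n : ℕ} {m : FatDelta} (f : incl.obj ⦋n⦌ₛ ⟶ m) (g : incl.obj ⦋1⦌ₛ ⟶ m)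
    (h : f.toEmb (Fin.last n) = g.toEmb (0 : Fin 2)) : incl.obj ⦋n + 1⦌ₛ ⟶ m :=
  ofStrictMono (n := n + 1) (Fin.lastCases (g.toEmb (1 : Fin 2)) f.toEmb)
    (lastCases_strictMono f.toEmb.strictMono
      (h.trans_lt (g.toEmb.strictMono (show (0 : Fin 2) < 1 by decide))))

theorem initial_glue {n : ℕ} {m : FatDelta} (f : incl.obj ⦋n⦌ₛ ⟶ m) (g : incl.obj ⦋1⦌ₛ ⟶ m)
    (h : f.toEmb (Fin.last n) = g.toEmb (0 : Fin 2)) : initial n ≫ glue f g h = f :=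
  hom_ext_apply fun i => Fin.lastCases_castSucc (motive := fun _ => Fin (m.len + 1))
    (last := g.toEmb (1 : Fin 2)) (cast := f.toEmb) i

theorem edge_glue {n : ℕ} {m : FatDelta} (f : incl.obj ⦋n⦌ₛ ⟶ m) (g : incl.obj ⦋1⦌ₛ ⟶ m)
    (h : f.toEmb (Fin.last n) = g.toEmb (0 : Fin 2)) : edge (Fin.last n) ≫ glue f g h = g :=
  hom_ext_apply fun i => by
    change Fin (1 + 1) at i
    induction i using Fin.lastCases with
    | last =>
      exact (Fin.lastCases_last (motive := fun _ => Fin (m.len + 1))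
        (last := g.toEmb (1 : Fin 2)) (cast := f.toEmb))
    | cast i =>
      obtain rfl := Fin.fin_one_eq_zero i
      exact (Fin.lastCases_castSucc (motive := fun _ => Fin (m.len + 1))
        (last := g.toEmb (1 : Fin 2)) (cast := f.toEmb) (Fin.last n)).trans h

theorem hom_ext_initial_edge {n : ℕ} {m : FatDelta} {f g : incl.obj ⦋n + 1⦌ₛ ⟶ m}
    (h₁ : initial n ≫ f = initial n ≫ g) (h₂ : edge (Fin.last n) ≫ f = edge (Fin.last n) ≫ g) :
    f = g :=
  hom_ext_apply fun i => by
    change Fin (n + 1 + 1) at i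
    induction i using Fin.lastCases with
    | last => exact congrArg (fun f : incl.obj ⦋1⦌ₛ ⟶ m => f.toEmb (1 : Fin 2)) h₂
    | cast i => exact congrArg (fun f : incl.obj ⦋n⦌ₛ ⟶ m => f.toEmb i) h₁

/-- Out of an ordinal without links every strictly increasing map is a morphism, and a map from
`[n]` and one from `[1]` agreeing at the common vertex glue to a strictly increasing map. -/
theorem isPushout_initial_edge (n : ℕ) :
    IsPushout (vertex (incl.obj ⦋n⦌ₛ) (Fin.last n)) (vertex (incl.obj ⦋1⦌ₛ) (0 : Fin 2))
      (initial n) (edge (Fin.last n)) where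
  w := rfl
  isColimit' := by
    have hs : ∀ s : Limits.PushoutCocone (vertex (incl.obj ⦋n⦌ₛ) (Fin.last n))
        (vertex (incl.obj ⦋1⦌ₛ) (0 : Fin 2)),
        s.inl.toEmb (Fin.last n) = s.inr.toEmb (0 : Fin 2) := fun s =>
      congrArg (fun f : pt ⟶ s.pt => f.toEmb (0 : Fin 1)) s.condition
    exact ⟨Limits.PushoutCocone.IsColimit.mk _ (fun s => glue s.inl s.inr (hs s))
      (fun s => initial_glue _ _ _) (fun s => edge_glue _ _ _)
      (fun s m h₁ h₂ => hom_ext_initial_edge (h₁.trans (initial_glue _ _ _).symm)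
        (h₂.trans (edge_glue _ _ _).symm))⟩

end FatDelta

/-- Induction on the number of edges: by the pushout above, `X_{n+2}` is the pullback of `X_{n+1}`
and `X₁` over `X₀`, which adds one factor. Starting at one edge, where the projection is an
identity, avoids a separate case for two. -/
theorem isIteratedPullback_edge (X : FairCat.{u}) (n : ℕ) :
    IsIteratedPullback X.src X.tgt (n + 1) (P := X.level (n + 1))
      (fun j => X.obj.map (FatDelta.edge j).op) := by
  have hcond : ∀ (r : ℕ) (i j : Fin r), i.val + 1 = j.val →
      X.obj.map (FatDelta.edge i).op ≫ X.tgt = X.obj.map (FatDelta.edge j).op ≫ X.src := by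
    intro r i j h
    refine (X.obj.map_comp _ _).symm.trans (Eq.trans ?_ (X.obj.map_comp _ _))
    exact congrArg (fun v : Fin (r + 1) => X.obj.map
      (FatDelta.vertex (FatDelta.incl.obj ⦋r⦌ₛ) v).op) (Fin.ext h : i.succ = j.castSucc)
  induction n with
  | zero =>
    have h1 : FatDelta.edge (0 : Fin 1) = 𝟙 (FatDelta.incl.obj ⦋1⦌ₛ) :=
      FatDelta.hom_ext_apply fun i => by
        change Fin (1 + 1) at i
        fin_cases i <;> rfl
    have h2 : X.obj.map (FatDelta.edge (0 : Fin 1)).op = 𝟙 (X.level 1) := by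
      rw [h1, op_id, X.obj.map_id]
    refine ⟨hcond 1, fun Q q _ => ⟨q 0, fun i => ?_, fun l hl => ?_⟩⟩
    · obtain rfl := Fin.fin_one_eq_zero i
      exact (congrArg (q 0 ≫ ·) h2).trans (Category.comp_id _)
    · exact ((congrArg (l ≫ ·) h2).trans (Category.comp_id _)).symm.trans (hl 0)
  | succ n ih =>
    have hpb := X.property.segal _ _ _ _ (FatDelta.isPushout_initial_edge (n + 1))
    have hinit : ∀ j : Fin (n + 1), X.obj.map (FatDelta.initial (n + 1)).op ≫
        X.obj.map (FatDelta.edge j).op = X.obj.map (FatDelta.edge j.castSucc).op := by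
      intro j
      rw [← X.obj.map_comp, ← op_comp]
      congr 2
      apply FatDelta.hom_ext_apply
      intro i
      change Fin (1 + 1) at i
      fin_cases i <;> rfl
    have hlast : X.obj.map (FatDelta.edge (Fin.last n)).op ≫ X.tgt =
        X.obj.map (FatDelta.vertex (FatDelta.incl.obj ⦋n + 1⦌ₛ) (Fin.last (n + 1))).op :=
      (X.obj.map_comp _ _).symm
    refine ⟨hcond _, fun Q q hq => ?_⟩
    obtain ⟨l, hl, hl'⟩ := ih.existsUnique_lift Q (fun j => q j.castSucc)
      (fun i j hij => hq _ _ hij)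
    refine ⟨hpb.lift l (q (Fin.last _)) ?_, ?_, ?_⟩
    · rw [← hlast, ← Category.assoc, hl]
      exact hq _ _ rfl
    · intro i
      induction i using Fin.lastCases with
      | last => exact hpb.lift_snd _ _ _
      | cast i =>
        change _ ≫ X.obj.map _ = _
        rw [← hinit, ← Category.assoc, hpb.lift_fst]
        exact hl i
    · intro l' h'
      apply hpb.hom_ext
      · rw [hpb.lift_fst]
        apply hl'
        intro i
        change (l' ≫ _) ≫ X.obj.map _ = _
        rw [Category.assoc, hinit]
        exact h' _
      · rw [hpb.lift_snd]
        exact h' _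

section

variable {X : FatDeltaᵒᵖ ⥤ Cat.{u, u}} (hX : IsColourPreserving X)

/-- Allows the faces and edges of `Δ` to be matched with maps of the fat delta by comparing vertices
only. -/
theorem tmap_eq_map {m n : ℕ} (f : (⦋m⦌ : SimplexCategory) ⟶ ⦋n⦌)
    (g : FatDelta.incl.obj ⦋m⦌ₛ ⟶ FatDelta.incl.obj ⦋n⦌ₛ)
    (h : ∀ i : Fin (m + 1), g.toEmb i = f.toOrderHom i) : tmap hX f = X.map g.op := by
  obtain rfl : f = SimplexCategory.Hom.mk g.toEmb.toOrderHom :=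
    SimplexCategory.Hom.ext _ _ (OrderHom.ext _ _ (funext fun i => (h i).symm))
  exact tmap_mono hX (m := ⦋m⦌ₛ) (n := ⦋n⦌ₛ) (SemiSimplexCategory.homEquiv.symm g.toEmb)

end

theorem tmap_src (X : FairCat.{u}) :
    tmap X.property.isColourPreserving (SimplexCategory.δ 1 : ⦋0⦌ ⟶ ⦋1⦌) = X.src :=
  tmap_eq_map _ _ _ fun i => by
    obtain rfl : i = 0 := Fin.fin_one_eq_zero i
    rfl

theorem tmap_tgt (X : FairCat.{u}) :
    tmap X.property.isColourPreserving (SimplexCategory.δ 0 : ⦋0⦌ ⟶ ⦋1⦌) = X.tgt :=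
  tmap_eq_map _ _ _ fun i => by
    obtain rfl : i = 0 := Fin.fin_one_eq_zero i
    rfl

theorem tmap_mkOfSucc (X : FairCat.{u}) {r : ℕ} (j : Fin r) :
    tmap X.property.isColourPreserving (SimplexCategory.mkOfSucc j) =
      X.obj.map (FatDelta.edge j).op :=
  tmap_eq_map _ _ _ fun i => by
    fin_cases i <;> rfl

theorem isIteratedPullback_tmap (X : FairCat.{u}) {r : ℕ} (hr : 2 ≤ r) :
    IsIteratedPullback X.src X.tgt r (P := X.level r)
      (fun j : Fin r => tmap X.property.isColourPreserving (SimplexCategory.mkOfSucc j)) := by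
  obtain ⟨n, rfl⟩ : ∃ n, r = n + 1 := ⟨r - 1, by omega⟩
  have := isIteratedPullback_edge X n
  simp only [tmap_mkOfSucc]
  exact this

theorem transportPs_isSegalic (X : FairCat.{u}) :
    (transportPs X.property.isColourPreserving).IsSegalic where
  discrete := X.property.discrete
  segal r hr := by
    have := isIteratedPullback_tmap X hr
    rw [← tmap_src, ← tmap_tgt] at this
    exact this

end Fair

theorem mainTheorem5 :
    ∃ T : Fair.FairCat.{u} ⥤ Fair.SSegPs.{u},
      -- on ordinals and monomorphisms `T X` is `X`, and `T F` is `F`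
      T ⋙ Fair.SSegPs.restrict = Fair.FairCat.restrict ∧
      -- `(T X)₀ = X₀`, `(T X)₁ = X₁`, and `(T X)_r` is the `r`-fold pullback of `X₁` over `X₀`
      (∀ X : Fair.FairCat.{u},
        ∃ (h₀ : (T.obj X).ps.level 0 = X.level 0) (h₁ : (T.obj X).ps.level 1 = X.level 1),
          (T.obj X).ps.act (SimplexCategory.δ 1 : ⦋0⦌ ⟶ ⦋1⦌) =
            eqToHom h₁ ≫ X.src ≫ eqToHom h₀.symm ∧
          (T.obj X).ps.act (SimplexCategory.δ 0 : ⦋0⦌ ⟶ ⦋1⦌) =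
            eqToHom h₁ ≫ X.tgt ≫ eqToHom h₀.symm ∧
          ∀ r : ℕ, 2 ≤ r →
            Fair.IsIteratedPullback X.src X.tgt r (P := (T.obj X).ps.level r)
              (fun j : Fin r => (T.obj X).ps.act (SimplexCategory.mkOfSucc j) ≫ eqToHom h₁)) ∧
      -- `π^*(T X)` is equivalent to `X` by transport along equivalences `X_{π k} ≃ X_k`
      ∀ X : Fair.FairCat.{u},
        ∃ t : Pseudofunctor.StrongTrans (T.obj X).projPullback X.toPs,
          (∀ k : Fair.FatDelta, (t.app ⟨op k⟩).toFunctor.IsEquivalence) ∧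
          ∀ n : SemiSimplexCategory,
            ∃ h, t.app ⟨op (Fair.FatDelta.incl.obj n)⟩ = eqToHom h := by
  -- Transport was made onto the categories `X_n` themselves, so the equalities in degrees `0` and
  -- `1` are `rfl`.
  refine ⟨Fair.transportFunctor Fair.transportPs_isSegalic,
    Fair.transportFunctor_restrict _, fun X => ⟨rfl, rfl, ?_, ?_, fun r hr => ?_⟩, fun X =>
      ⟨Fair.comparisonTrans X.property.isColourPreserving, fun k => ?_, fun n => ?_⟩⟩
  · exact Fair.tmap_src X
  · exact Fair.tmap_tgt X
  · exact Fair.isIteratedPullback_tmap X hr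
  · exact Fair.cmp_isEquivalence _ k
  · exact ⟨_, Fair.cmp_linkFree _ _ rfl⟩
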